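/- Let $k,l$ be integers with $1\le l<k$, put $p=k/l>1$, let $r\in\mathbb{R}$, and put $c(p)=p^p(p-1)^{1-p}$. Let $$\psi_{p,r}(\sigma)=\frac{\Gamma\big((\sigma-1)p+r+1\big)}{\Gamma(\sigma)\,\Gamma\big((\sigma-1)(p-1)+r+1\big)},$$ where at points $\sigma$ at which one of the Gamma factors has a pole the right-hand side is understood as a limit. Let $$\alpha_j=\frac{j}{l}\ (1\le j\le l),\qquad \alpha_j=\frac{r+j-l}{k-l}\ (l+1\le j\le k),\qquad \beta_j=\frac{r+j}{k}\ (1\le j\le k).$$ For $0<z<1$ the Meijer function is $$G^{k,0}_{k,k}\!\left(\left.\begin{matrix}\alpha_1,\ldots,\alpha_k\\ \beta_1,\ldots,\beta_k\end{matrix}\right|z\right)=\frac{1}{2\pi\mathrm{i}}\int_{L}\frac{\prod_{j=1}^{k}\Gamma(\beta_j-s)}{\prod_{j=1}^{k}\Gamma(\alpha_j-s)}\,z^{s}\,ds,$$ where the loop $L$ starts and ends at $+\infty$ and encircles all poles of the functions $\Gamma(\beta_j-s)$ once in the negative sense. (a) For every $x\in(0,c(p))$ the inverse Mellin transform $$V_{p,r}(x)=\frac{1}{2\pi\mathrm{i}}\int_{d-\mathrm{i}\infty}^{d+\mathrm{i}\infty}x^{-\sigma}\psi_{p,r}(\sigma)\,d\sigma$$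 exists as a convergent improper integral for every real $d>1-\frac{1+r}{p}$, and its value does not depend on $d$. (b) For every $x\in(0,c(p))$ the integral that defines the Meijer function at $x^l/c(p)^l$ converges absolutely, and $$V_{p,r}(x)=\frac{p^{r+1/2}\sqrt{l}}{x\,(p-1)^{r+1/2}\sqrt{2\pi}}\;G^{k,0}_{k,k}\!\left(\left.\begin{matrix}\alpha_1,\ldots,\alpha_k\\ \beta_1,\ldots,\beta_k\end{matrix}\right|\frac{x^{l}}{c(p)^{l}}\right).$$ (c) For every complex $\sigma$ with $\Re\sigma>1-\frac{1+r}{p}$ the function $x\mapsto x^{\sigma-1}V_{p,r}(x)$ is integrable on $(0,c(p))$, and $$\psi_{p,r}(\sigma)=\int_{0}^{c(p)}x^{\sigma-1}V_{p,r}(x)\,dx.$$ -/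

import Mathlib

open Real Set Filter Topology MeasureTheory

noncomputable section

/-- `c(p) = p^p (p-1)^(1-p)`. -/
def cConst (p : ℝ) : ℝ := p ^ p * (p - 1) ^ (1 - p)

/-- The Gamma quotient `Γ((σ-1)p+r+1) / (Γ(σ) Γ((σ-1)(p-1)+r+1))`. It is meant at those `σ` at which
none of the three Gamma factors has a pole. -/
def gammaQuotient (p r : ℝ) (σ : ℂ) : ℂ :=
  Complex.Gamma ((σ - 1) * p + r + 1) /
    (Complex.Gamma σ * Complex.Gamma ((σ - 1) * (p - 1) + r + 1))

/-- `ψ_{p,r}(σ)`, understood at every `σ` as the limit of the Gamma quotient at `σ`. The critical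
points are isolated, so elsewhere this is the quotient itself. -/
def psi (p r : ℝ) (σ : ℂ) : ℂ := limUnder (𝓝[≠] σ) (gammaQuotient p r)

/-- The upper parameters `α_1, …, α_k`; the index `i : Fin k` stands for `j = i + 1`. -/
def alphaParam (k l : ℕ) (r : ℝ) (i : Fin k) : ℝ :=
  if (i : ℕ) + 1 ≤ l then ((i : ℝ) + 1) / l else (r + ((i : ℝ) + 1) - l) / ((k : ℝ) - l)

/-- The lower parameters `β_1, …, β_k`; the index `i : Fin k` stands for `j = i + 1`. -/
def betaParam (k : ℕ) (r : ℝ) (i : Fin k) : ℝ := (r + ((i : ℝ) + 1)) / k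

/-- `HasInverseMellin f d x v`: the improper integral
`(1 / (2πi)) ∫_{d-i∞}^{d+i∞} x^(-σ) f(σ) dσ` along the line `σ = d + it` converges to `v`,
the two ends of the line going to infinity independently of each other. -/
def HasInverseMellin (f : ℂ → ℂ) (d x : ℝ) (v : ℂ) : Prop :=
  (∀ S T : ℝ, IntervalIntegrable
    (fun t : ℝ => (x : ℂ) ^ (-((d : ℂ) + t * Complex.I)) * f ((d : ℂ) + t * Complex.I))
      volume S T) ∧
  Tendsto
    (fun w : ℝ × ℝ => 1 / (2 * (π : ℂ) * Complex.I) *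
      ∫ t in (-w.1)..w.2,
        (x : ℂ) ^ (-((d : ℂ) + t * Complex.I)) * f ((d : ℂ) + t * Complex.I) * Complex.I)
    (atTop ×ˢ atTop) (𝓝 v)

/-- The integrand `∏ Γ(b_j - s) / ∏ Γ(a_j - s) · z^s` of the Meijer function `G^{q,0}_{p,q}`.
(Where some `Γ(a_j - s)` has a pole the value is `0`, as it should be, if no `b_j - s` is one.) -/
def meijerKernel {p q : ℕ} (a : Fin p → ℂ) (b : Fin q → ℂ) (z s : ℂ) : ℂ :=
  (∏ j, Complex.Gamma (b j - s)) / (∏ j, Complex.Gamma (a j - s)) * z ^ s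

/-- `HasMeijerG a b z g`: the Meijer function `G^{q,0}_{p,q}(a; b | z)` exists and has the value `g`.
It is `(1 / (2πi)) ∫_L ∏ Γ(b_j - s) / ∏ Γ(a_j - s) · z^s ds`, where the loop `L` starts and ends at
`+∞` and encircles all poles of the functions `Γ(b_j - s)` once in the negative sense (the standard
contour for `p < q`, and for `p = q` and `0 < |z| < 1`). The loops used here come in along
`Im s = -R` from `+∞` to `c - iR`, go up to `c + iR`, and return to `+∞` along `Im s = R`.
For all of them the integral has to converge absolutely and to have the value `g`. -/
def HasMeijerG {p q : ℕ} (a : Fin p → ℂ) (b : Fin q → ℂ) (z g : ℂ) : Prop :=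
  ∀ c R : ℝ, 0 < R → (∀ j, c < (b j).re) → (∀ j, |(b j).im| < R) →
    IntegrableOn (fun t : ℝ => meijerKernel a b z ((t : ℂ) - R * Complex.I)) (Ioi c) ∧
    IntervalIntegrable (fun t : ℝ => meijerKernel a b z ((c : ℂ) + t * Complex.I)) volume (-R) R ∧
    IntegrableOn (fun t : ℝ => meijerKernel a b z ((t : ℂ) + R * Complex.I)) (Ioi c) ∧
    1 / (2 * (π : ℂ) * Complex.I) *
      (-(∫ t in Ioi c, meijerKernel a b z ((t : ℂ) - R * Complex.I))
        + (∫ t in (-R)..R, meijerKernel a b z ((c : ℂ) + t * Complex.I) * Complex.I)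
        + ∫ t in Ioi c, meijerKernel a b z ((t : ℂ) + R * Complex.I)) = g

end

/-!
With `w = (σ - 1) / l`, the function `ψ_{p,r}(σ)` is the binomial coefficient
`Γ(k w + r + 1) / (Γ(l w + 1) Γ((k - l) w + r + 1))`. Up to an elementary factor it equals the
quotient `F(s) = ∏ Γ(β_j - s) / ∏ Γ(α_j - s)` at `s = -w` (`gammaBinom_eq_mul_gammaRatio`). This is
Gauss's multiplication formula applied three times, but only the combination is needed: both sides
satisfy the same recursion under `w ↦ w + 1`, and Euler's limit formula together with Stirling's
formula for factorials compares them at infinity. So the substitution `σ = 1 - l s` turns the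
integrand of the inverse Mellin transform into that of the Meijer function.

All the analysis rests on the decay `F(s) = O(‖β - s‖ ^ (-1 / 2))`, `β = min β_j`, at a positive
distance from the ray `[β, ∞)` (`norm_gammaRatio_le`). Because `∑ α_j - ∑ β_j = 1 / 2`, the quantity
`‖F(s)‖ ^ 2 * ‖β - s‖` changes under `s ↦ s - 1` by a factor `1 + O(‖β - s‖ ^ (-2))` only, and it
tends to `1` along `s - n`; the product of these factors is bounded uniformly in `s`. No Stirling
formula for the complex Gamma function and no reflection formula is involved.

The decay has three consequences.
* By Cauchy's theorem on half-strips, the ends of the vertical line `Re s = c` can be turned to the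
  right, so the improper vertical integral converges to the loop integral, which does not depend on
  the loop (`tendsto_integral_vertical_loopIntegral`, `IsSlitDecaying.loopIntegral_mul_cpow_eq`).
* The loop integral converges absolutely, so in its Mellin transform the integrations can be
  exchanged (`mellin_superposition`); what remains is the loop integral of `F(s) / (s - s₀)` with
  `s₀ = (1 - σ) / l` to the left of the loop.
* Closing the contour to the left, where `F` is analytic and decays, this is `2πi F(s₀)`
  (`IsSlitDecaying.loopIntegral_div_sub`), that is, `ψ_{p,r}(σ)` up to the elementary factor.
-/

/-! ### Gamma quotients and their limits -/

/-- The quotient `∏ Γ(b_j - s) / ∏ Γ(a_j - s)`, that is, the Meijer kernel without its factor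
`z ^ s`. Since Mathlib puts `Γ = 0` at the poles, it is `0` where some `Γ(a_j - s)` has a pole,
which is the value of the analytic continuation as long as no `Γ(b_j - s)` has a pole there. -/
noncomputable def gammaRatio {ι : Type*} [Fintype ι] (a b : ι → ℝ) (s : ℂ) : ℂ :=
  (∏ j, Complex.Gamma (b j - s)) / ∏ j, Complex.Gamma (a j - s)

lemma Gamma_add_natCast_eq_mul_prod (s : ℂ) (n : ℕ) (h : ∀ j : ℕ, s + j ≠ 0) :
    Complex.Gamma (s + n) = Complex.Gamma s * ∏ j ∈ Finset.range n, (s + j) := by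
  induction n with
  | zero => simp
  | succ n ih =>
    rw [Finset.prod_range_succ, ← mul_assoc, ← ih, mul_comm, ← Complex.Gamma_add_one _ (h n)]
    push_cast
    ring_nf

lemma tendsto_Gamma_add_natCast_div_of_re_pos {s : ℂ} (hs : 0 < s.re) :
    Tendsto (fun n : ℕ => Complex.Gamma (s + n + 1) / ((n : ℂ) ^ s * (n.factorial : ℂ)))
      atTop (𝓝 1) := by
  have hne : ∀ j : ℕ, s + j ≠ 0 := fun j h => by
    have := congrArg Complex.re h
    simp at this
    have : (0 : ℝ) ≤ j := by positivity
    linarith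
  have hG := Complex.Gamma_ne_zero_of_re_pos hs
  have h1 := (tendsto_const_nhds (x := Complex.Gamma s)).div (Complex.GammaSeq_tendsto_Gamma s) hG
  rw [div_self hG] at h1
  refine h1.congr fun n => ?_
  have h2 := Gamma_add_natCast_eq_mul_prod s (n + 1) hne
  have h3 : s + n + 1 = s + ((n + 1 : ℕ) : ℂ) := by push_cast; ring
  rw [Pi.div_apply, h3, h2, Complex.GammaSeq, div_div_eq_mul_div]

/-- `Γ(s + n + 1) ~ n ^ s * n!` as `n → ∞`, for every complex `s`. -/
lemma tendsto_Gamma_add_natCast_div (s : ℂ) :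
    Tendsto (fun n : ℕ => Complex.Gamma (s + n + 1) / ((n : ℂ) ^ s * (n.factorial : ℂ)))
      atTop (𝓝 1) := by
  have key : ∀ s : ℂ, Tendsto (fun n : ℕ => Complex.Gamma (s + 1 + n + 1) /
      ((n : ℂ) ^ (s + 1) * (n.factorial : ℂ))) atTop (𝓝 1) →
      Tendsto (fun n : ℕ => Complex.Gamma (s + n + 1) / ((n : ℂ) ^ s * (n.factorial : ℂ)))
        atTop (𝓝 1) := by
    intro s h
    rw [← tendsto_add_atTop_iff_nat 1]
    have h1 : Tendsto (fun n : ℕ => (n : ℝ) / (n + 1)) atTop (𝓝 1) :=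
      tendsto_natCast_div_add_atTop (1 : ℝ)
    have h2 : Tendsto (fun n : ℕ => (((n : ℝ) / (n + 1) : ℝ) : ℂ) ^ (s + 1)) atTop (𝓝 1) := by
      have h3 : Tendsto (fun n : ℕ => (((n : ℝ) / (n + 1) : ℝ) : ℂ)) atTop (𝓝 ((1 : ℝ) : ℂ)) :=
        (Complex.continuous_ofReal.tendsto _).comp h1
      have h4 := h3.cpow (tendsto_const_nhds (x := s + 1)) (by simp)
      simpa using h4
    have h5 := h.mul h2
    rw [one_mul] at h5
    refine h5.congr' ?_
    filter_upwards [eventually_ge_atTop 1] with n hn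
    have hn0 : (n : ℂ) ≠ 0 := Nat.cast_ne_zero.2 (by lia)
    have hn1 : ((n : ℂ) + 1) ≠ 0 := by exact_mod_cast Nat.succ_ne_zero n
    have e1 : (((n : ℝ) / (n + 1) : ℝ) : ℂ) ^ (s + 1) =
        (n : ℂ) ^ (s + 1) / ((n : ℂ) + 1) ^ (s + 1) := by
      have := Complex.div_cpow_ofReal_nonneg (n.cast_nonneg : (0 : ℝ) ≤ n)
        (by positivity : (0 : ℝ) ≤ n + 1) (s + 1)
      rw [Complex.ofReal_div, this]
      push_cast
      rfl
    have e2 : ((n : ℂ) + 1) ^ (s + 1) = ((n : ℂ) + 1) ^ s * (n + 1) := by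
      rw [Complex.cpow_add _ _ hn1, Complex.cpow_one]
    have hp1 : (n : ℂ) ^ (s + 1) ≠ 0 := by simp [Complex.cpow_eq_zero_iff, hn0]
    have hp2 : ((n : ℂ) + 1) ^ s ≠ 0 := by simp [Complex.cpow_eq_zero_iff, hn1]
    have hf : (n.factorial : ℂ) ≠ 0 := Nat.cast_ne_zero.2 n.factorial_ne_zero
    rw [e1, e2, Nat.factorial_succ]
    push_cast
    rw [show s + 1 + (n : ℂ) + 1 = s + (n + 1) + 1 by ring]
    field_simp
  obtain ⟨m, hm⟩ := exists_nat_gt (-s.re)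
  induction m generalizing s with
  | zero => exact tendsto_Gamma_add_natCast_div_of_re_pos (by simpa using hm)
  | succ m ih =>
    refine key s (ih (s + 1) ?_)
    rw [Complex.add_re, Complex.one_re]
    push_cast at hm
    linarith

lemma gammaRatio_eq_sub_one_mul {ι : Type*} [Fintype ι] (a b : ι → ℝ) (s : ℂ)
    (h : ∀ j, (b j : ℂ) - s ≠ 0) :
    gammaRatio a b s = gammaRatio a b (s - 1) * ∏ j, ((a j : ℂ) - s) / (b j - s) := by
  have e1 : ∀ j, Complex.Gamma (b j - s) = Complex.Gamma (b j - (s - 1)) / (b j - s) := fun j => by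
    rw [show (b j : ℂ) - (s - 1) = b j - s + 1 by ring, Complex.Gamma_add_one _ (h j),
      mul_div_cancel_left₀ _ (h j)]
  have e2 : ∀ j, (Complex.Gamma (a j - s))⁻¹ = (a j - s) * (Complex.Gamma (a j - (s - 1)))⁻¹ :=
    fun j => by
      have := Complex.one_div_Gamma_eq_self_mul_one_div_Gamma_add_one (a j - s)
      rw [this, show (a j : ℂ) - (s - 1) = a j - s + 1 by ring]
  simp only [gammaRatio, div_eq_mul_inv, ← Finset.prod_inv_distrib, e1, e2, Finset.prod_mul_distrib]
  ring

lemma gammaRatio_eq_sub_natCast_mul {ι : Type*} [Fintype ι] (a b : ι → ℝ) (s : ℂ) (n : ℕ)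
    (h : ∀ j, ∀ m : ℕ, (b j : ℂ) - s + m ≠ 0) :
    gammaRatio a b s = gammaRatio a b (s - n) *
      ∏ m ∈ Finset.range n, ∏ j, ((a j : ℂ) - s + m) / (b j - s + m) := by
  induction n with
  | zero => simp
  | succ n ih =>
    rw [ih, gammaRatio_eq_sub_one_mul a b (s - n), Finset.prod_range_succ]
    · rw [show s - n - 1 = s - ((n + 1 : ℕ) : ℂ) by push_cast; ring]
      simp only [sub_sub_eq_add_sub, add_sub_right_comm]
      ring
    · intro j
      have := h j n
      rwa [← sub_add]

/-- Along `s - n`, the Gamma quotient is asymptotic to `n ^ (∑ b_j - ∑ a_j)`. -/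
lemma tendsto_gammaRatio_sub_natCast {ι : Type*} [Fintype ι] (a b : ι → ℝ) (s : ℂ) :
    Tendsto (fun n : ℕ => gammaRatio a b (s - (n + 1)) * (n : ℂ) ^ ((∑ j, a j - ∑ j, b j : ℝ) : ℂ))
      atTop (𝓝 1) := by
  have hb := tendsto_finsetProd (Finset.univ : Finset ι)
    (fun j _ => tendsto_Gamma_add_natCast_div ((b j : ℂ) - s))
  have ha := tendsto_finsetProd (Finset.univ : Finset ι)
    (fun j _ => tendsto_Gamma_add_natCast_div ((a j : ℂ) - s))
  have h := hb.div ha (by simp)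
  simp only [Finset.prod_const_one, div_one] at h
  refine h.congr' ?_
  filter_upwards [eventually_ge_atTop 1] with n hn
  have hn0 : (n : ℂ) ≠ 0 := Nat.cast_ne_zero.2 (by lia)
  have hf : (n.factorial : ℂ) ≠ 0 := Nat.cast_ne_zero.2 n.factorial_ne_zero
  have hpow : ∀ c : ι → ℝ, ∏ j, (n : ℂ) ^ ((c j : ℂ) - s) =
      (n : ℂ) ^ (((∑ j, c j : ℝ) : ℂ) - Fintype.card ι * s) := by
    intro c
    simp only [Complex.cpow_def_of_ne_zero hn0, ← Complex.exp_sum, ← Finset.mul_sum,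
      Finset.sum_sub_distrib]
    simp
  have hp : ∀ c : ℂ, (n : ℂ) ^ c ≠ 0 := fun c => by simp [Complex.cpow_eq_zero_iff, hn0]
  have e : ∀ c : ι → ℝ, ∀ j, Complex.Gamma ((c j : ℂ) - s + n + 1) =
      Complex.Gamma (c j - (s - (n + 1))) := fun c j => by ring_nf
  simp only [gammaRatio, Pi.div_apply, Finset.prod_div_distrib, Finset.prod_mul_distrib, hpow, e]
  have e3 : (n : ℂ) ^ ((∑ j, a j - ∑ j, b j : ℝ) : ℂ) =
      (n : ℂ) ^ (((∑ j, a j : ℝ) : ℂ) - Fintype.card ι * s) /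
        (n : ℂ) ^ (((∑ j, b j : ℝ) : ℂ) - Fintype.card ι * s) := by
    rw [← Complex.cpow_sub _ _ hn0]
    push_cast
    ring_nf
  have hF : ∏ _j : ι, (n.factorial : ℂ) ≠ 0 := by simp [hf]
  have h1 := hp (((∑ j, b j : ℝ) : ℂ) - Fintype.card ι * s)
  have h2 := hp (((∑ j, a j : ℝ) : ℂ) - Fintype.card ι * s)
  rw [e3]
  generalize (n : ℂ) ^ (((∑ j, a j : ℝ) : ℂ) - Fintype.card ι * s) = A at *
  generalize (n : ℂ) ^ (((∑ j, b j : ℝ) : ℂ) - Fintype.card ι * s) = B at *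
  field_simp

/-! ### Decay of Gamma quotients -/

lemma norm_one_add_le_exp (u : ℂ) : ‖1 + u‖ ≤ Real.exp (u.re + ‖u‖ ^ 2 / 2) := by
  have h1 : ‖1 + u‖ ^ 2 = (2 * u.re + ‖u‖ ^ 2) + 1 := by
    rw [Complex.sq_norm, Complex.sq_norm, Complex.normSq_apply, Complex.normSq_apply]
    simp
    ring
  have h2 : ‖1 + u‖ ^ 2 ≤ Real.exp (u.re + ‖u‖ ^ 2 / 2) ^ 2 := by
    rw [h1, ← Real.exp_nat_mul]
    refine (Real.add_one_le_exp _).trans (Real.exp_le_exp.2 (le_of_eq ?_))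
    push_cast
    ring
  exact le_of_sq_le_sq h2 (Real.exp_pos _).le

lemma le_norm_of_le_re_or_le_abs_im {ε : ℝ} {u : ℂ} (hu : ε ≤ u.re ∨ ε ≤ |u.im|) : ε ≤ ‖u‖ := by
  rcases hu with h | h
  · exact h.trans (Complex.re_le_norm u)
  · exact h.trans (Complex.abs_im_le_norm u)

lemma le_re_or_le_abs_im_add {ε b : ℝ} {u : ℂ} (hb : 0 ≤ b) (hu : ε ≤ u.re ∨ ε ≤ |u.im|) :
    ε ≤ (u + b).re ∨ ε ≤ |(u + b).im| := by
  rcases hu with h | h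
  · left
    simp
    linarith
  · right
    simpa using h

/-- The first-order estimate of `(u + b + d) / (u + b)`, uniform in the region
`ε ≤ Re u ∨ ε ≤ |Im u|`. -/
lemma norm_add_add_div_le_exp {ε b : ℝ} (hε : 0 < ε) (hb : 0 ≤ b) (d : ℝ) :
    ∃ K : ℝ, 0 ≤ K ∧ ∀ u : ℂ, (ε ≤ u.re ∨ ε ≤ |u.im|) →
      ‖(u + b + d) / (u + b)‖ ≤ Real.exp (d * (1 / u).re + K / ‖u‖ ^ 2) := by
  set κ := 1 + b / ε with hκ
  have hκ0 : 0 < κ := by positivity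
  refine ⟨|d| * b * κ + d ^ 2 * κ ^ 2 / 2, by positivity, fun u hu => ?_⟩
  have hu1 := le_norm_of_le_re_or_le_abs_im hu
  have hub := le_norm_of_le_re_or_le_abs_im (le_re_or_le_abs_im_add hb hu)
  have hu0 : 0 < ‖u‖ := hε.trans_le hu1
  have hub0 : 0 < ‖u + b‖ := hε.trans_le hub
  have hne : u ≠ 0 := norm_pos_iff.1 hu0
  have hbne : u + b ≠ 0 := norm_pos_iff.1 hub0
  have hcmp : ‖u‖ ≤ κ * ‖u + b‖ := by
    have h1 : ‖u‖ ≤ ‖u + b‖ + b := by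
      have := norm_sub_le (u + b) (b : ℂ)
      simpa [abs_of_nonneg hb] using this
    have h2 : b ≤ b / ε * ‖u + b‖ := by
      rw [div_mul_eq_mul_div, le_div_iff₀ hε]
      gcongr
    rw [hκ]
    linarith
  have hinv : ‖u + b‖⁻¹ ≤ κ * ‖u‖⁻¹ := by
    rw [← div_eq_mul_inv, inv_le_comm₀ hub0 (by positivity), inv_div, div_le_iff₀ hκ0]
    linarith
  have e1 : (u + b + d) / (u + b) = 1 + d / (u + b) := by field_simp
  rw [e1]
  refine (norm_one_add_le_exp _).trans (Real.exp_le_exp.2 ?_)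
  have e2 : (d : ℂ) / (u + b) = d * (1 / u) + -(d * b) * (u⁻¹ * (u + b)⁻¹) := by
    field_simp
    ring
  have h3 : ((d : ℂ) / (u + b)).re ≤ d * (1 / u).re + |d| * b * κ / ‖u‖ ^ 2 := by
    rw [e2, Complex.add_re, Complex.re_ofReal_mul]
    gcongr
    refine (Complex.re_le_norm _).trans ?_
    rw [norm_mul, norm_neg, norm_mul, norm_mul, norm_inv, norm_inv, Complex.norm_real,
      Complex.norm_real, Real.norm_eq_abs, Real.norm_eq_abs, abs_of_nonneg hb]
    calc |d| * b * (‖u‖⁻¹ * ‖u + b‖⁻¹) ≤ |d| * b * (‖u‖⁻¹ * (κ * ‖u‖⁻¹)) := by gcongr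
      _ = |d| * b * κ / ‖u‖ ^ 2 := by field_simp
  have h4 : ‖(d : ℂ) / (u + b)‖ ^ 2 / 2 ≤ d ^ 2 * κ ^ 2 / 2 / ‖u‖ ^ 2 := by
    rw [norm_div, Complex.norm_real, Real.norm_eq_abs, div_eq_mul_inv |d|, mul_pow, sq_abs]
    calc d ^ 2 * (‖u + b‖⁻¹) ^ 2 / 2 ≤ d ^ 2 * (κ * ‖u‖⁻¹) ^ 2 / 2 := by gcongr
      _ = d ^ 2 * κ ^ 2 / 2 / ‖u‖ ^ 2 := by field_simp
  rw [add_div]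
  linarith

/-- The inverse squares `1 / ‖u + j‖ ^ 2` are dominated by a telescoping sequence that is bounded
uniformly in `u`. -/
lemma inv_norm_sq_le_arctan_sub {ε : ℝ} (hε : 0 < ε) {u : ℂ} (hu : ε ≤ u.re ∨ ε ≤ |u.im|) :
    1 / ‖u‖ ^ 2 ≤ 2 * (2 + 3 / ε ^ 2) * (Real.arctan (u.re + 1) - Real.arctan u.re) := by
  obtain ⟨ξ, hξ, he⟩ := exists_hasDerivAt_eq_slope Real.arctan (fun x => 1 / (1 + x ^ 2))
    (show u.re < u.re + 1 by linarith) Real.continuous_arctan.continuousOn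
    (fun x _ => Real.hasDerivAt_arctan x)
  rw [add_sub_cancel_left, div_one] at he
  rw [← he]
  have h1 : 1 + ξ ^ 2 ≤ 3 + 2 * u.re ^ 2 := by
    obtain ⟨h, h'⟩ := hξ
    nlinarith [sq_nonneg (ξ - 2 * u.re), sq_nonneg (u.re - 1), sq_nonneg (u.re + 1)]
  have h2 : (u.re ^ 2 + ε ^ 2) / 2 ≤ ‖u‖ ^ 2 := by
    have h3 : u.re ^ 2 ≤ ‖u‖ ^ 2 := by
      rw [← sq_abs]
      gcongr
      exact Complex.abs_re_le_norm u
    have h4 : ε ^ 2 ≤ ‖u‖ ^ 2 := by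
      gcongr
      exact le_norm_of_le_re_or_le_abs_im hu
    linarith
  calc 1 / ‖u‖ ^ 2 ≤ 1 / ((u.re ^ 2 + ε ^ 2) / 2) := by gcongr
    _ ≤ 2 * (2 + 3 / ε ^ 2) * (1 / (3 + 2 * u.re ^ 2)) := by
        rw [mul_one_div, div_le_div_iff₀ (by positivity) (by positivity)]
        have : 2 * (2 + 3 / ε ^ 2) * ((u.re ^ 2 + ε ^ 2) / 2) =
            3 + 2 * u.re ^ 2 + (2 * ε ^ 2 + 3 * u.re ^ 2 / ε ^ 2) := by
          field_simp
          ring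
        rw [this]
        have : 0 ≤ 2 * ε ^ 2 + 3 * u.re ^ 2 / ε ^ 2 := by positivity
        linarith
    _ ≤ 2 * (2 + 3 / ε ^ 2) * (1 / (1 + ξ ^ 2)) := by gcongr

/-- When `∑ a_j - ∑ b_j = 1 / 2`, the quantity `‖gammaRatio a b s‖ ^ 2 * ‖β - s‖` changes under
`s ↦ s - 1` only by a factor `1 + O(‖β - s‖ ^ (-2))`: the first-order terms cancel. -/
lemma gammaRatio_sq_mul_norm_le_sub_one {ι : Type*} [Fintype ι] (a b : ι → ℝ) {β ε : ℝ}
    (hε : 0 < ε) (hβ : ∀ j, β ≤ b j) (hab : ∑ j, a j - ∑ j, b j = 1 / 2) :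
    ∃ K : ℝ, 0 ≤ K ∧ ∀ s : ℂ, (ε ≤ (β - s).re ∨ ε ≤ |((β : ℂ) - s).im|) →
      ‖gammaRatio a b s‖ ^ 2 * ‖β - s‖ ≤
        ‖gammaRatio a b (s - 1)‖ ^ 2 * ‖β - (s - 1)‖ * Real.exp (K / ‖β - s‖ ^ 2) := by
  have hb0 : ∀ j, 0 ≤ b j - β := fun j => sub_nonneg.2 (hβ j)
  choose K hK0 hK using fun j => norm_add_add_div_le_exp hε (hb0 j) (a j - b j)
  obtain ⟨K', hK'0, hK'⟩ := norm_add_add_div_le_exp hε zero_le_one (-1)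
  refine ⟨2 * ∑ j, K j + K', by have := Finset.sum_nonneg fun j (_ : j ∈ Finset.univ) => hK0 j
                                positivity, fun s hs => ?_⟩
  have hne : ∀ j, (b j : ℂ) - s ≠ 0 := fun j => by
    have h1 := le_norm_of_le_re_or_le_abs_im (le_re_or_le_abs_im_add (hb0 j) hs)
    rw [← norm_pos_iff]
    refine (hε.trans_le h1).trans_le (le_of_eq ?_)
    congr 1
    push_cast
    ring
  have h1 : ∏ j, ‖((a j : ℂ) - s) / (b j - s)‖ ≤
      Real.exp ((1 / 2) * (1 / ((β : ℂ) - s)).re + (∑ j, K j) / ‖β - s‖ ^ 2) := by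
    rw [← hab, ← Finset.sum_sub_distrib, Finset.sum_mul, Finset.sum_div, ← Finset.sum_add_distrib,
      Real.exp_sum]
    refine Finset.prod_le_prod (fun j _ => norm_nonneg _) fun j _ => ?_
    have := hK j _ hs
    rwa [show (β : ℂ) - s + (b j - β : ℝ) = b j - s by push_cast; ring,
      show (b j : ℂ) - s + (a j - b j : ℝ) = a j - s by push_cast; ring] at this
  have h2 : ‖(β : ℂ) - s‖ ≤ ‖β - (s - 1)‖ *
      Real.exp (-(1 / ((β : ℂ) - s)).re + K' / ‖β - s‖ ^ 2) := by
    have h3 := hK' _ hs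
    have h4 := le_norm_of_le_re_or_le_abs_im (le_re_or_le_abs_im_add zero_le_one hs)
    have h5 : 0 < ‖(β : ℂ) - (s - 1)‖ := by
      refine (hε.trans_le h4).trans_le (le_of_eq ?_)
      congr 1
      push_cast
      ring
    rw [← div_le_iff₀' h5, ← norm_div]
    rwa [show (β : ℂ) - s + (1 : ℝ) + (-1 : ℝ) = β - s by push_cast; ring,
      show (β : ℂ) - s + (1 : ℝ) = β - (s - 1) by push_cast; ring, neg_one_mul] at h3
  rw [gammaRatio_eq_sub_one_mul a b s hne, norm_mul, norm_prod]
  calc (‖gammaRatio a b (s - 1)‖ * ∏ j, ‖((a j : ℂ) - s) / (b j - s)‖) ^ 2 * ‖(β : ℂ) - s‖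
      ≤ (‖gammaRatio a b (s - 1)‖ *
          Real.exp ((1 / 2) * (1 / ((β : ℂ) - s)).re + (∑ j, K j) / ‖β - s‖ ^ 2)) ^ 2 *
        (‖β - (s - 1)‖ * Real.exp (-(1 / ((β : ℂ) - s)).re + K' / ‖β - s‖ ^ 2)) := by
        gcongr
    _ = ‖gammaRatio a b (s - 1)‖ ^ 2 * ‖β - (s - 1)‖ *
        (Real.exp ((1 / 2) * (1 / ((β : ℂ) - s)).re + (∑ j, K j) / ‖β - s‖ ^ 2) ^ 2 *
          Real.exp (-(1 / ((β : ℂ) - s)).re + K' / ‖β - s‖ ^ 2)) := by ring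
    _ = _ := by
        rw [← Real.exp_nat_mul, ← Real.exp_add]
        congr 2
        push_cast
        ring

lemma tendsto_gammaRatio_sq_mul_norm {ι : Type*} [Fintype ι] (a b : ι → ℝ) (β : ℝ)
    (hab : ∑ j, a j - ∑ j, b j = 1 / 2) (s : ℂ) :
    Tendsto (fun n : ℕ => ‖gammaRatio a b (s - (n + 1))‖ ^ 2 * ‖β - (s - (n + 1))‖)
      atTop (𝓝 1) := by
  have h1 := ((tendsto_gammaRatio_sub_natCast a b s).norm).pow 2
  rw [hab] at h1
  have h2 : Tendsto (fun n : ℕ => ((n : ℂ) / (n + (β - s + 1)))⁻¹) atTop (𝓝 1) := by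
    simpa using (tendsto_natCast_div_add_atTop ((β : ℂ) - s + 1)).inv₀ one_ne_zero
  have h3 := h1.mul h2.norm
  simp only [norm_one, one_pow, mul_one] at h3
  refine h3.congr' ?_
  filter_upwards [eventually_ge_atTop 1] with n hn
  have hn0 : (0 : ℝ) < n := by exact_mod_cast hn
  have e1 : ‖(n : ℂ) ^ ((1 / 2 : ℝ) : ℂ)‖ ^ 2 = n := by
    rw [← Complex.ofReal_natCast, Complex.norm_cpow_eq_rpow_re_of_pos hn0, Complex.ofReal_re,
      ← Real.sqrt_eq_rpow, Real.sq_sqrt hn0.le]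
  rw [norm_mul, mul_pow, e1, inv_div, norm_div, Complex.norm_natCast,
    show (n : ℂ) + (β - s + 1) = β - (s - (n + 1)) by ring]
  field_simp

/-- The Stirling-type decay of the Gamma quotient away from the ray `[β, ∞)` that carries its
poles. -/
theorem norm_gammaRatio_le {ι : Type*} [Fintype ι] (a b : ι → ℝ) {β ε : ℝ}
    (hε : 0 < ε) (hβ : ∀ j, β ≤ b j) (hab : ∑ j, a j - ∑ j, b j = 1 / 2) :
    ∃ C : ℝ, 0 < C ∧ ∀ s : ℂ, (ε ≤ (β - s).re ∨ ε ≤ |((β : ℂ) - s).im|) →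
      ‖gammaRatio a b s‖ ≤ C * ‖β - s‖ ^ (-(1 / 2) : ℝ) := by
  obtain ⟨K, hK0, hK⟩ := gammaRatio_sq_mul_norm_le_sub_one a b hε hβ hab
  set M := K * (2 * (2 + 3 / ε ^ 2)) with hM
  have hM0 : 0 ≤ M := by positivity
  let H : ℂ → ℝ := fun s => ‖gammaRatio a b s‖ ^ 2 * ‖β - s‖
  have hH0 : ∀ s, 0 ≤ H s := fun s => by positivity
  -- `H s * exp (M * arctan (β - Re s))` increases along `s, s - 1, s - 2, …`
  have hstep : ∀ s : ℂ, (ε ≤ (β - s).re ∨ ε ≤ |((β : ℂ) - s).im|) →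
      H s * Real.exp (M * Real.arctan (β - s.re)) ≤
        H (s - 1) * Real.exp (M * Real.arctan (β - (s - 1).re)) := by
    intro s hs
    have h1 := inv_norm_sq_le_arctan_sub hε hs
    have h2 : K / ‖β - s‖ ^ 2 ≤
        M * (Real.arctan (β - (s - 1).re) - Real.arctan (β - s.re)) := by
      have := mul_le_mul_of_nonneg_left h1 hK0
      rw [mul_one_div] at this
      refine this.trans (le_of_eq ?_)
      simp only [Complex.sub_re, Complex.ofReal_re, Complex.one_re, hM]
      ring_nf
    calc H s * Real.exp (M * Real.arctan (β - s.re))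
        ≤ H (s - 1) * Real.exp (K / ‖β - s‖ ^ 2) * Real.exp (M * Real.arctan (β - s.re)) := by
          gcongr
          exact hK s hs
      _ ≤ H (s - 1) * Real.exp (M * (Real.arctan (β - (s - 1).re) - Real.arctan (β - s.re))) *
          Real.exp (M * Real.arctan (β - s.re)) := by
          gcongr
      _ = _ := by
          rw [mul_assoc, ← Real.exp_add]
          ring_nf
  have hiter : ∀ n : ℕ, ∀ s : ℂ, (ε ≤ (β - s).re ∨ ε ≤ |((β : ℂ) - s).im|) →
      H s * Real.exp (M * Real.arctan (β - s.re)) ≤ H (s - n) * Real.exp (M * (π / 2)) := by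
    intro n
    induction n with
    | zero =>
      intro s _
      rw [Nat.cast_zero, sub_zero]
      have := (Real.arctan_lt_pi_div_two (β - s.re)).le
      gcongr
    | succ n ih =>
      intro s hs
      refine (hstep s hs).trans ((ih (s - 1) ?_).trans (le_of_eq ?_))
      · have := le_re_or_le_abs_im_add zero_le_one hs
        rwa [show (β : ℂ) - s + (1 : ℝ) = β - (s - 1) by push_cast; ring] at this
      · rw [show s - 1 - (n : ℂ) = s - (n + 1 : ℕ) by push_cast; ring]
  have hbound : ∀ s : ℂ, (ε ≤ (β - s).re ∨ ε ≤ |((β : ℂ) - s).im|) →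
      H s ≤ Real.exp (M * π) := by
    intro s hs
    have h1 := (tendsto_gammaRatio_sq_mul_norm a b β hab s).mul_const (Real.exp (M * (π / 2)))
    have h2 := ge_of_tendsto' h1 fun n => by
      have := hiter (n + 1) s hs
      push_cast at this
      exact this
    rw [one_mul] at h2
    have h3 : Real.exp (M * (-(π / 2))) ≤ Real.exp (M * Real.arctan (β - s.re)) := by
      have := (Real.neg_pi_div_two_lt_arctan (β - s.re)).le
      gcongr
    have h4 := (mul_le_mul_of_nonneg_left h3 (hH0 s)).trans h2
    rw [← le_div_iff₀ (Real.exp_pos _), ← Real.exp_sub] at h4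
    refine h4.trans (le_of_eq ?_)
    ring_nf
  refine ⟨Real.exp (M * π / 2), Real.exp_pos _, fun s hs => ?_⟩
  have hpos : 0 < ‖(β : ℂ) - s‖ := hε.trans_le (le_norm_of_le_re_or_le_abs_im hs)
  rw [Real.rpow_neg hpos.le, ← Real.sqrt_eq_rpow, ← div_eq_mul_inv,
    le_div_iff₀ (Real.sqrt_pos.2 hpos)]
  refine le_of_sq_le_sq ?_ (Real.exp_pos _).le
  rw [mul_pow, Real.sq_sqrt hpos.le, ← Real.exp_nat_mul]
  refine (hbound s hs).trans (le_of_eq ?_)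
  push_cast
  ring_nf

/-! ### Recursion and Stirling asymptotics of the binomial coefficient -/

/-- The binomial coefficient `((l + m) w + r choose l w)` for complex `w`, written with Gamma
functions. -/
noncomputable def gammaBinom (l m : ℕ) (r : ℝ) (w : ℂ) : ℂ :=
  Complex.Gamma (((l + m : ℕ) : ℂ) * w + r + 1) /
    (Complex.Gamma (l * w + 1) * Complex.Gamma (m * w + r + 1))

lemma inv_Gamma_eq_prod_mul (s : ℂ) (n : ℕ) :
    (Complex.Gamma s)⁻¹ = (∏ j ∈ Finset.range n, (s + j)) * (Complex.Gamma (s + n))⁻¹ := by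
  induction n with
  | zero => simp
  | succ n ih =>
    rw [ih, Complex.one_div_Gamma_eq_self_mul_one_div_Gamma_add_one (s + n),
      Finset.prod_range_succ, mul_assoc]
    push_cast
    ring_nf

lemma prod_natCast_mul_add (k : ℕ) (hk : k ≠ 0) (w c : ℂ) :
    ∏ j ∈ Finset.range k, (k * w + c + 1 + j) =
      (k : ℂ) ^ k * ∏ i : Fin k, ((c + ((i : ℂ) + 1)) / k + w) := by
  have hk0 : (k : ℂ) ≠ 0 := Nat.cast_ne_zero.2 hk
  rw [Finset.prod_range, ← Fin.prod_const, ← Finset.prod_mul_distrib]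
  refine Finset.prod_congr rfl fun i _ => ?_
  field_simp
  ring

lemma alphaParam_castAdd {l m : ℕ} (r : ℝ) (i : Fin l) :
    alphaParam (l + m) l r (Fin.castAdd m i) = ((i : ℝ) + 1) / l := by
  have : (i : ℕ) + 1 ≤ l := i.2
  simp [alphaParam, this]

lemma alphaParam_natAdd {l m : ℕ} (r : ℝ) (i : Fin m) :
    alphaParam (l + m) l r (Fin.natAdd l i) = (r + ((i : ℝ) + 1)) / m := by
  have : ¬ l + (i : ℕ) + 1 ≤ l := by lia
  simp only [alphaParam, Fin.val_natAdd, this, if_false]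
  push_cast
  ring_nf

lemma sum_add_div (k : ℕ) (hk : k ≠ 0) (r : ℝ) :
    ∑ i : Fin k, (r + ((i : ℝ) + 1)) / k = r + (k + 1) / 2 := by
  have hk0 : (k : ℝ) ≠ 0 := Nat.cast_ne_zero.2 hk
  have h : ∑ i ∈ Finset.range k, (i : ℝ) = k * (k - 1) / 2 := by
    clear hk hk0
    induction k with
    | zero => simp
    | succ n ih => rw [Finset.sum_range_succ, ih]; push_cast; ring
  rw [← Finset.sum_div, Finset.sum_add_distrib, Finset.sum_add_distrib,
    ← Finset.sum_range (fun i => (i : ℝ)), h]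
  simp
  field_simp
  ring

lemma sum_alphaParam_sub_sum_betaParam {l m : ℕ} (hl : l ≠ 0) (hm : m ≠ 0) (r : ℝ) :
    ∑ i, alphaParam (l + m) l r i - ∑ i, betaParam (l + m) r i = 1 / 2 := by
  have h1 := sum_add_div l hl 0
  simp only [zero_add] at h1
  simp only [Fin.sum_univ_add, alphaParam_castAdd, alphaParam_natAdd, betaParam, h1,
    sum_add_div m hm r]
  have h2 := sum_add_div (l + m) (by lia) r
  rw [Fin.sum_univ_add] at h2
  rw [h2]
  push_cast
  ring

lemma prod_alphaParam_sub {l m : ℕ} (r : ℝ) (s : ℂ) :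
    ∏ i, ((alphaParam (l + m) l r i : ℂ) - s) =
      (∏ i : Fin l, (((i : ℂ) + 1) / l - s)) * ∏ i : Fin m, ((r + ((i : ℂ) + 1)) / m - s) := by
  rw [Fin.prod_univ_add]
  simp only [alphaParam_castAdd, alphaParam_natAdd]
  push_cast
  rfl

lemma gammaBinom_eq_add_one_mul {l m : ℕ} (hl : l ≠ 0) (hm : m ≠ 0) (r : ℝ) (w : ℂ)
    (hw : ∀ i, (betaParam (l + m) r i : ℂ) + w ≠ 0) :
    gammaBinom l m r w = gammaBinom l m r (w + 1) *
      ((l : ℂ) ^ l * (m : ℂ) ^ m / ((l + m : ℕ) : ℂ) ^ (l + m)) *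
        ∏ i, ((alphaParam (l + m) l r i : ℂ) + w) / (betaParam (l + m) r i + w) := by
  have hk : l + m ≠ 0 := by lia
  have hk0 : ((l + m : ℕ) : ℂ) ≠ 0 := Nat.cast_ne_zero.2 hk
  have h1 := prod_natCast_mul_add (l + m) hk w r
  have h2 := prod_natCast_mul_add l hl w 0
  have h3 := prod_natCast_mul_add m hm w r
  have g1 := inv_Gamma_eq_prod_mul (((l + m : ℕ) : ℂ) * w + r + 1) (l + m)
  have g2 := inv_Gamma_eq_prod_mul (l * w + 1) l
  have g3 := inv_Gamma_eq_prod_mul (m * w + r + 1) m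
  have ha := prod_alphaParam_sub (l := l) (m := m) r (-w)
  simp only [sub_neg_eq_add] at ha
  simp only [zero_add, add_zero] at h2
  have hb : ∏ i : Fin (l + m), (((r : ℂ) + ((i : ℂ) + 1)) / ((l + m : ℕ) : ℂ) + w) =
      ∏ i, ((betaParam (l + m) r i : ℂ) + w) := by
    refine Finset.prod_congr rfl fun i _ => ?_
    simp [betaParam]
  have hb0 : ∏ i, ((betaParam (l + m) r i : ℂ) + w) ≠ 0 := Finset.prod_ne_zero_iff.2 fun i _ => hw i
  rw [h1, hb] at g1
  rw [h2] at g2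
  rw [h3] at g3
  rw [← inv_inj, inv_inv, mul_inv, mul_inv, inv_inv] at g1
  rw [Finset.prod_div_distrib, ha, gammaBinom, gammaBinom, div_eq_mul_inv, mul_inv, g1, g2, g3,
    show ((l + m : ℕ) : ℂ) * (w + 1) + r + 1 =
      ((l + m : ℕ) : ℂ) * w + r + 1 + ((l + m : ℕ) : ℂ) by ring,
    show (l : ℂ) * (w + 1) + 1 = l * w + 1 + l by ring,
    show (m : ℂ) * (w + 1) + r + 1 = m * w + r + 1 + m by ring]
  field_simp

lemma gammaBinom_eq_add_natCast_mul {l m : ℕ} (hl : l ≠ 0) (hm : m ≠ 0) (r : ℝ) (w : ℂ)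
    (hw : ∀ i, ∀ n : ℕ, (betaParam (l + m) r i : ℂ) + w + n ≠ 0) (n : ℕ) :
    gammaBinom l m r w = gammaBinom l m r (w + n) *
      ((l : ℂ) ^ l * (m : ℂ) ^ m / ((l + m : ℕ) : ℂ) ^ (l + m)) ^ n *
        ∏ j ∈ Finset.range n, ∏ i, ((alphaParam (l + m) l r i : ℂ) + w + j) /
          (betaParam (l + m) r i + w + j) := by
  induction n with
  | zero => simp
  | succ n ih =>
    rw [ih, gammaBinom_eq_add_one_mul hl hm r (w + n), Finset.prod_range_succ]
    · rw [show w + n + 1 = w + ((n + 1 : ℕ) : ℂ) by push_cast; ring]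
      simp only [add_assoc]
      ring
    · intro i
      rw [← add_assoc]
      exact hw i n

lemma factorial_eq_stirlingSeq_mul {n : ℕ} (hn : n ≠ 0) :
    (n.factorial : ℝ) = Stirling.stirlingSeq n * (√(2 * n) * (n / Real.exp 1) ^ n) := by
  have : (0 : ℝ) < n := by positivity
  rw [Stirling.stirlingSeq, div_mul_cancel₀]
  positivity

/-- Stirling's formula for the binomial coefficients `((l + m) n choose l n)`. -/
lemma tendsto_factorial_quotient {l m : ℕ} (hl : l ≠ 0) (hm : m ≠ 0) :
    Tendsto (fun n : ℕ => (((l + m) * n).factorial : ℝ) / ((l * n).factorial * (m * n).factorial) *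
      ((l : ℝ) ^ l * (m : ℝ) ^ m / ((l + m : ℕ) : ℝ) ^ (l + m)) ^ n * √n) atTop
      (𝓝 (√((l + m : ℕ) / (2 * π * l * m)))) := by
  have hS : ∀ c : ℕ, c ≠ 0 → Tendsto (fun n : ℕ => Stirling.stirlingSeq (c * n)) atTop (𝓝 √π) :=
    fun c hc => Stirling.tendsto_stirlingSeq_sqrt_pi.comp
      (tendsto_id.const_mul_atTop' (Nat.pos_of_ne_zero hc))
  have hk : l + m ≠ 0 := by lia
  have hpi : √π ≠ 0 := (Real.sqrt_pos.2 Real.pi_pos).ne'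
  have h := (((hS _ hk).div ((hS l hl).mul (hS m hm)) (mul_ne_zero hpi hpi)).mul_const
    (√((l + m : ℕ) / (2 * l * m))))
  have e : √π / (√π * √π) * √((l + m : ℕ) / (2 * l * m)) = √((l + m : ℕ) / (2 * π * l * m)) := by
    rw [div_mul_cancel_left₀ hpi, ← Real.sqrt_inv, ← Real.sqrt_mul (by positivity)]
    congr 1
    field_simp
  rw [e] at h
  refine h.congr' ?_
  filter_upwards [eventually_ge_atTop 1] with n hn
  have hn0 : n ≠ 0 := by lia
  simp only [Pi.div_apply]
  rw [factorial_eq_stirlingSeq_mul (mul_ne_zero hk hn0),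
    factorial_eq_stirlingSeq_mul (mul_ne_zero hl hn0),
    factorial_eq_stirlingSeq_mul (mul_ne_zero hm hn0)]
  have hS0 : ∀ c : ℕ, c ≠ 0 → Stirling.stirlingSeq (c * n) ≠ 0 := fun c hc => by
    obtain ⟨j, hj⟩ := Nat.exists_eq_succ_of_ne_zero (mul_ne_zero hc hn0)
    rw [hj]
    exact (Stirling.stirlingSeq'_pos j).ne'
  have h1 := hS0 l hl
  have h2 := hS0 m hm
  have hlR : (0 : ℝ) < l := by positivity
  have hmR : (0 : ℝ) < m := by positivity
  have hnR : (0 : ℝ) < n := by positivity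
  have hkR : (0 : ℝ) < ((l + m : ℕ) : ℝ) := by positivity
  have hpow : ((((l + m) * n : ℕ) : ℝ) / Real.exp 1) ^ ((l + m) * n) *
      ((l : ℝ) ^ l * (m : ℝ) ^ m / ((l + m : ℕ) : ℝ) ^ (l + m)) ^ n =
      (((l * n : ℕ) : ℝ) / Real.exp 1) ^ (l * n) * (((m * n : ℕ) : ℝ) / Real.exp 1) ^ (m * n) := by
    rw [Nat.cast_mul, Nat.cast_mul, Nat.cast_mul, pow_mul, pow_mul, pow_mul, ← mul_pow, ← mul_pow]
    congr 1
    have := Real.exp_pos 1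
    rw [div_pow, div_pow, div_pow, mul_pow, mul_pow, mul_pow, pow_add (n : ℝ), pow_add (Real.exp 1)]
    field_simp
  have hsq : √(2 * (((l + m) * n : ℕ) : ℝ)) * √n = √((l + m : ℕ) / (2 * l * m)) *
      (√(2 * ((l * n : ℕ) : ℝ)) * √(2 * ((m * n : ℕ) : ℝ))) := by
    rw [← Real.sqrt_mul (by positivity), ← Real.sqrt_mul (by positivity),
      ← Real.sqrt_mul (by positivity)]
    congr 1
    rw [Nat.cast_mul, Nat.cast_mul, Nat.cast_mul]
    field_simp
  have hA : (((l * n : ℕ) : ℝ) / Real.exp 1) ^ (l * n) ≠ 0 := by positivity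
  have hB : (((m * n : ℕ) : ℝ) / Real.exp 1) ^ (m * n) ≠ 0 := by positivity
  have hC : √(2 * ((l * n : ℕ) : ℝ)) ≠ 0 := by positivity
  have hD : √(2 * ((m * n : ℕ) : ℝ)) ≠ 0 := by positivity
  generalize (((l * n : ℕ) : ℝ) / Real.exp 1) ^ (l * n) = A at *
  generalize (((m * n : ℕ) : ℝ) / Real.exp 1) ^ (m * n) = B at *
  generalize √(2 * ((l * n : ℕ) : ℝ)) = C at *
  generalize √(2 * ((m * n : ℕ) : ℝ)) = D at *
  generalize ((((l + m) * n : ℕ) : ℝ) / Real.exp 1) ^ ((l + m) * n) = E at *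
  generalize ((l : ℝ) ^ l * (m : ℝ) ^ m / ((l + m : ℕ) : ℝ) ^ (l + m)) ^ n = P at *
  generalize √(2 * (((l + m) * n : ℕ) : ℝ)) = R at *
  generalize √((l + m : ℕ) / (2 * l * m) : ℝ) = G at *
  generalize √(n : ℝ) = X at *
  have : ∀ S : ℝ, S * (R * E) / (Stirling.stirlingSeq (l * n) * (C * A) *
      (Stirling.stirlingSeq (m * n) * (D * B))) * P * X =
      S * (R * X) * (E * P) / (Stirling.stirlingSeq (l * n) * (C * A) *
      (Stirling.stirlingSeq (m * n) * (D * B))) := fun S => by ring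
  rw [this, hsq, hpow]
  field_simp

/-! ### The multiplication formula -/

lemma tendsto_gammaBinom_add_natCast {l m : ℕ} (hl : l ≠ 0) (hm : m ≠ 0) (r : ℝ) (w : ℂ) :
    Tendsto (fun n : ℕ => gammaBinom l m r (w + n) *
      ((l : ℂ) ^ l * (m : ℂ) ^ m / ((l + m : ℕ) : ℂ) ^ (l + m)) ^ n * ((√n : ℝ) : ℂ)) atTop
      (𝓝 (((l + m : ℕ) : ℂ) ^ (((l + m : ℕ) : ℂ) * w + r) /
        ((l : ℂ) ^ ((l : ℂ) * w) * (m : ℂ) ^ ((m : ℂ) * w + r)) *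
          (√((l + m : ℕ) / (2 * π * l * m)) : ℝ))) := by
  have hk : l + m ≠ 0 := by lia
  have hT : ∀ c : ℕ, c ≠ 0 → ∀ s : ℂ, Tendsto (fun n : ℕ => Complex.Gamma (s + (c * n : ℕ) + 1) /
      (((c * n : ℕ) : ℂ) ^ s * ((c * n).factorial : ℂ))) atTop (𝓝 1) := fun c hc s =>
    (tendsto_Gamma_add_natCast_div s).comp (tendsto_id.const_mul_atTop' (Nat.pos_of_ne_zero hc))
  have h1 := (hT _ hk (((l + m : ℕ) : ℂ) * w + r)).div
    ((hT l hl (l * w)).mul (hT m hm (m * w + r))) (by simp)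
  have h2 := (Complex.continuous_ofReal.tendsto _).comp (tendsto_factorial_quotient hl hm)
  have h3 := (h1.mul_const (((l + m : ℕ) : ℂ) ^ (((l + m : ℕ) : ℂ) * w + r) /
        ((l : ℂ) ^ ((l : ℂ) * w) * (m : ℂ) ^ ((m : ℂ) * w + r)))).mul h2
  rw [mul_one, div_one, one_mul] at h3
  refine h3.congr' ?_
  filter_upwards [eventually_ge_atTop 1] with n hn
  have hn0 : (n : ℂ) ≠ 0 := Nat.cast_ne_zero.2 (by lia)
  have hlC : (l : ℂ) ≠ 0 := Nat.cast_ne_zero.2 hl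
  have hmC : (m : ℂ) ≠ 0 := Nat.cast_ne_zero.2 hm
  have hkC : ((l + m : ℕ) : ℂ) ≠ 0 := Nat.cast_ne_zero.2 hk
  have hp : ∀ z : ℂ, z ≠ 0 → ∀ c : ℂ, z ^ c ≠ 0 := fun z hz c => by
    simp [Complex.cpow_eq_zero_iff, hz]
  simp only [Pi.div_apply, Function.comp_apply, gammaBinom]
  rw [show ((l + m : ℕ) : ℂ) * (w + n) + r + 1 =
      ((l + m : ℕ) : ℂ) * w + r + (((l + m) * n : ℕ) : ℂ) + 1 by push_cast; ring,
    show (l : ℂ) * (w + n) + 1 = l * w + ((l * n : ℕ) : ℂ) + 1 by push_cast; ring,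
    show (m : ℂ) * (w + n) + r + 1 = m * w + r + ((m * n : ℕ) : ℂ) + 1 by push_cast; ring]
  have hc : ∀ (c : ℕ) (s : ℂ), ((c * n : ℕ) : ℂ) ^ s = (c : ℂ) ^ s * (n : ℂ) ^ s := fun c s => by
    rw [Nat.cast_mul, Complex.natCast_mul_natCast_cpow]
  have hnpow : (n : ℂ) ^ (((l + m : ℕ) : ℂ) * w + r) =
      (n : ℂ) ^ ((l : ℂ) * w) * (n : ℂ) ^ ((m : ℂ) * w + r) := by
    rw [← Complex.cpow_add _ _ hn0]
    push_cast
    ring_nf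
  rw [hc, hc, hc, hnpow]
  have f1 := hp _ hlC (l * w)
  have f2 := hp _ hmC (m * w + r)
  have f3 := hp _ hkC (((l + m : ℕ) : ℂ) * w + r)
  have f4 := hp _ hn0 (l * w)
  have f5 := hp _ hn0 (m * w + r)
  have g1 : ((l * n).factorial : ℂ) ≠ 0 := Nat.cast_ne_zero.2 (Nat.factorial_ne_zero _)
  have g2 : ((m * n).factorial : ℂ) ≠ 0 := Nat.cast_ne_zero.2 (Nat.factorial_ne_zero _)
  have g3 : (((l + m) * n).factorial : ℂ) ≠ 0 := Nat.cast_ne_zero.2 (Nat.factorial_ne_zero _)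
  generalize (l : ℂ) ^ ((l : ℂ) * w) = a1 at *
  generalize (m : ℂ) ^ ((m : ℂ) * w + r) = a2 at *
  generalize ((l + m : ℕ) : ℂ) ^ (((l + m : ℕ) : ℂ) * w + r) = a3 at *
  generalize (n : ℂ) ^ ((l : ℂ) * w) = a4 at *
  generalize (n : ℂ) ^ ((m : ℂ) * w + r) = a5 at *
  rw [Complex.ofReal_mul, Complex.ofReal_mul, Complex.ofReal_div, Complex.ofReal_mul,
    Complex.ofReal_pow, Complex.ofReal_div, Complex.ofReal_mul, Complex.ofReal_pow,
    Complex.ofReal_pow, Complex.ofReal_pow]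
  simp only [Complex.ofReal_natCast]
  generalize ((l : ℂ) ^ l * (m : ℂ) ^ m / ((l + m : ℕ) : ℂ) ^ (l + m)) ^ n = P at *
  generalize Complex.Gamma (l * w + ((l * n : ℕ) : ℂ) + 1) = G1 at *
  generalize Complex.Gamma (m * w + r + ((m * n : ℕ) : ℂ) + 1) = G2 at *
  generalize Complex.Gamma (((l + m : ℕ) : ℂ) * w + r + (((l + m) * n : ℕ) : ℂ) + 1) = G3 at *
  field_simp

/-- The form of Gauss's multiplication formula that is needed: the three products of Gamma functions
combine to the binomial coefficient. Both sides satisfy the same recursion under `w ↦ w + 1`, and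
Stirling's formula compares them at infinity. -/
theorem gammaBinom_eq_mul_gammaRatio {l m : ℕ} (hl : l ≠ 0) (hm : m ≠ 0) (r : ℝ) (w : ℂ)
    (hw : ∀ i, 0 < betaParam (l + m) r i + w.re) :
    gammaBinom l m r w = ((l + m : ℕ) : ℂ) ^ (((l + m : ℕ) : ℂ) * w + r) /
        ((l : ℂ) ^ ((l : ℂ) * w) * (m : ℂ) ^ ((m : ℂ) * w + r)) *
          (√((l + m : ℕ) / (2 * π * l * m)) : ℝ) *
      gammaRatio (alphaParam (l + m) l r) (betaParam (l + m) r) (-w) := by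
  have hne : ∀ i, ∀ n : ℕ, (betaParam (l + m) r i : ℂ) + w + n ≠ 0 := fun i n h => by
    have h1 := congrArg Complex.re h
    simp at h1
    have := hw i
    have : (0 : ℝ) ≤ n := n.cast_nonneg
    linarith
  have h1 := tendsto_gammaBinom_add_natCast hl hm r w
  have h2 := tendsto_gammaRatio_sub_natCast (alphaParam (l + m) l r) (betaParam (l + m) r) (1 - w)
  rw [sum_alphaParam_sub_sum_betaParam hl hm] at h2
  have h3 := (h1.div h2 one_ne_zero).mul_const
    (gammaRatio (alphaParam (l + m) l r) (betaParam (l + m) r) (-w))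
  rw [div_one] at h3
  refine tendsto_nhds_unique (tendsto_const_nhds.congr' ?_) h3
  have h4 := h2.eventually_ne one_ne_zero
  filter_upwards [h4] with n hn
  rw [Pi.div_apply, gammaBinom_eq_add_natCast_mul hl hm r w hne n,
    gammaRatio_eq_sub_natCast_mul _ _ (-w) n (by simpa using hne)]
  have e1 : ((n : ℂ)) ^ ((1 / 2 : ℝ) : ℂ) = ((√n : ℝ) : ℂ) := by
    rw [Real.sqrt_eq_rpow, Complex.ofReal_cpow n.cast_nonneg]
    simp
  rw [e1, show 1 - w - ((n : ℂ) + 1) = -w - n by ring] at hn ⊢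
  simp only [sub_neg_eq_add]
  have hn1 := left_ne_zero_of_mul hn
  have hn2 := right_ne_zero_of_mul hn
  field_simp

/-! ### Contour deformation -/

/-- The integral of `g` over the loop that comes in along `Im s = -R` from `+∞` to `c - iR`, goes up
to `c + iR`, and returns to `+∞` along `Im s = R`. -/
noncomputable def loopIntegral (g : ℂ → ℂ) (c R : ℝ) : ℂ :=
  -(∫ t in Ioi c, g ((t : ℂ) - R * Complex.I))
    + (∫ t in (-R)..R, g ((c : ℂ) + t * Complex.I) * Complex.I)
    + ∫ t in Ioi c, g ((t : ℂ) + R * Complex.I)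

lemma integrableOn_horizontal {g : ℂ → ℂ} {c y : ℝ} {h : ℝ → ℝ}
    (hg : ContinuousOn (fun t : ℝ => g (t + y * Complex.I)) (Ioi c))
    (hh : IntegrableOn h (Ioi c)) (hb : ∀ t, c < t → ‖g (t + y * Complex.I)‖ ≤ h t) :
    IntegrableOn (fun t : ℝ => g (t + y * Complex.I)) (Ioi c) :=
  Integrable.mono' hh (hg.aestronglyMeasurable measurableSet_Ioi)
    ((ae_restrict_mem measurableSet_Ioi).mono fun t ht => hb t ht)

/-- Cauchy's theorem for a half-strip. -/
lemma integral_halfStrip {g : ℂ → ℂ} {c y₁ y₂ : ℝ} {h : ℝ → ℝ}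
    (hd : DifferentiableOn ℂ g (Ici c ×ℂ uIcc y₁ y₂))
    (hh : IntegrableOn h (Ioi c)) (h0 : Tendsto h atTop (𝓝 0))
    (hb : ∀ t, c < t → ∀ y ∈ uIcc y₁ y₂, ‖g (t + y * Complex.I)‖ ≤ h t) :
    (∫ t in Ioi c, g (t + y₁ * Complex.I)) - (∫ t in Ioi c, g (t + y₂ * Complex.I)) =
      ∫ y in y₁..y₂, g (c + y * Complex.I) * Complex.I := by
  have hcont : ∀ y ∈ uIcc y₁ y₂, ContinuousOn (fun t : ℝ => g (t + y * Complex.I)) (Ioi c) := by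
    intro y hy
    refine hd.continuousOn.comp (by fun_prop) fun t ht => ?_
    simp only [Complex.mem_reProdIm, Complex.add_re, Complex.ofReal_re, Complex.mul_re,
      Complex.I_re, Complex.ofReal_im, Complex.I_im, Complex.add_im, Complex.mul_im, mem_Ici]
    simp only [mem_Ioi] at ht
    constructor
    · linarith
    · simpa using hy
  have hi1 := integrableOn_horizontal (hcont y₁ left_mem_uIcc) hh
    fun t ht => hb t ht _ left_mem_uIcc
  have hi2 := integrableOn_horizontal (hcont y₂ right_mem_uIcc) hh
    fun t ht => hb t ht _ right_mem_uIcc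
  have t1 := (intervalIntegral_tendsto_integral_Ioi c hi1 tendsto_id).sub
    (intervalIntegral_tendsto_integral_Ioi c hi2 tendsto_id)
  have t2 : Tendsto (fun X : ℝ => Complex.I • ∫ y in y₁..y₂, g (X + y * Complex.I)) atTop
      (𝓝 0) := by
    have h1 : Tendsto (fun X : ℝ => h X * |y₂ - y₁|) atTop (𝓝 0) := by
      simpa using h0.mul_const |y₂ - y₁|
    refine squeeze_zero_norm' ?_ h1
    filter_upwards [eventually_gt_atTop c] with X hX
    rw [norm_smul, Complex.norm_I, one_mul]
    exact intervalIntegral.norm_integral_le_of_norm_le_const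
      fun y hy => hb X hX y (uIoc_subset_uIcc hy)
  have t3 := t1.add t2
  rw [add_zero] at t3
  refine tendsto_nhds_unique t3 (tendsto_const_nhds.congr' ?_)
  filter_upwards [eventually_gt_atTop c] with X hX
  have hr := Complex.integral_boundary_rect_eq_zero_of_differentiableOn g
    (c + y₁ * Complex.I) (X + y₂ * Complex.I) (hd.mono ?_)
  · simp only [Complex.add_re, Complex.ofReal_re, Complex.mul_re,
      Complex.I_re, Complex.ofReal_im, Complex.I_im, Complex.add_im, Complex.mul_im, mul_zero,
      mul_one, sub_zero, zero_add, add_zero] at hr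
    rw [intervalIntegral.integral_mul_const, mul_comm, ← smul_eq_mul]
    simp only [id]
    linear_combination -hr
  · simp only [Complex.add_re, Complex.ofReal_re, Complex.mul_re,
      Complex.I_re, Complex.ofReal_im, Complex.I_im, Complex.add_im, Complex.mul_im, mul_zero,
      mul_one, sub_zero, zero_add, add_zero]
    refine inter_subset_inter (preimage_mono ?_) subset_rfl
    rw [uIcc_of_le hX.le]
    exact Icc_subset_Ici_self

lemma tendsto_integral_horizontal {g : ℂ → ℂ} {c : ℝ} {h : ℝ → ℝ} {l : Filter ℝ}
    [l.IsCountablyGenerated]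
    (hg : ∀ᶠ y : ℝ in l, ContinuousOn (fun t : ℝ => g (t + y * Complex.I)) (Ioi c))
    (hh : IntegrableOn h (Ioi c))
    (hb : ∀ᶠ y : ℝ in l, ∀ t, c < t → ‖g (t + y * Complex.I)‖ ≤ h t)
    (hlim : ∀ t, c < t → Tendsto (fun y : ℝ => g (t + y * Complex.I)) l (𝓝 0)) :
    Tendsto (fun y : ℝ => ∫ t in Ioi c, g (t + y * Complex.I)) l (𝓝 0) := by
  have := tendsto_integral_filter_of_dominated_convergence (μ := volume.restrict (Ioi c))
    (l := l) (F := fun (y t : ℝ) => g (t + y * Complex.I)) (f := fun _ => 0) h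
    (hg.mono fun y hy => hy.aestronglyMeasurable measurableSet_Ioi)
    (hb.mono fun y hy => (ae_restrict_mem measurableSet_Ioi).mono fun t ht => hy t ht) hh
    ((ae_restrict_mem measurableSet_Ioi).mono fun t ht => hlim t ht)
  simpa using this

lemma continuousOn_horizontal {g : ℂ → ℂ} {c R : ℝ}
    (hd : DifferentiableOn ℂ g {s | c ≤ s.re ∧ R ≤ |s.im|}) {y : ℝ} (hy : R ≤ |y|) :
    ContinuousOn (fun t : ℝ => g (t + y * Complex.I)) (Ioi c) := by
  refine hd.continuousOn.comp (by fun_prop) fun t ht => ?_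
  simp only [mem_Ioi] at ht
  simpa using ⟨ht.le, hy⟩

/-- Turning the two ends of a vertical line towards `+∞`: the improper integral along `Re s = c`
converges, with independent ends, to the integral over the loop. -/
theorem tendsto_integral_vertical_loopIntegral {g : ℂ → ℂ} {c R : ℝ} {h : ℝ → ℝ}
    (hd : DifferentiableOn ℂ g {s | c ≤ s.re ∧ R ≤ |s.im|})
    (hv : Continuous fun y : ℝ => g (c + y * Complex.I))
    (hh : IntegrableOn h (Ioi c)) (h0 : Tendsto h atTop (𝓝 0))
    (hb : ∀ t, c < t → ∀ y : ℝ, R ≤ |y| → ‖g (t + y * Complex.I)‖ ≤ h t)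
    (htop : ∀ t, c < t → Tendsto (fun y : ℝ => g (t + y * Complex.I)) atTop (𝓝 0))
    (hbot : ∀ t, c < t → Tendsto (fun y : ℝ => g (t + y * Complex.I)) atBot (𝓝 0)) :
    Tendsto (fun w : ℝ × ℝ => ∫ t in (-w.1)..w.2, g (c + t * Complex.I) * Complex.I)
      (atTop ×ˢ atTop) (𝓝 (loopIntegral g c R)) := by
  have hRa : ∀ y, R ≤ y → R ≤ |y| := fun y hy => hy.trans (le_abs_self y)
  have hRb : ∀ y, y ≤ -R → R ≤ |y| := fun y hy => (le_neg.2 hy).trans (neg_le_abs y)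
  have T1 : Tendsto (fun y : ℝ => ∫ t in Ioi c, g (t + y * Complex.I)) atTop (𝓝 0) :=
    tendsto_integral_horizontal ((eventually_ge_atTop R).mono fun y hy =>
      continuousOn_horizontal hd (hRa y hy)) hh
      ((eventually_ge_atTop R).mono fun y hy t ht => hb t ht y (hRa y hy)) htop
  have T2 : Tendsto (fun y : ℝ => ∫ t in Ioi c, g (t + y * Complex.I)) atBot (𝓝 0) :=
    tendsto_integral_horizontal ((eventually_le_atBot (-R)).mono fun y hy =>
      continuousOn_horizontal hd (hRb y hy)) hh
      ((eventually_le_atBot (-R)).mono fun y hy t ht => hb t ht y (hRb y hy)) hbot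
  have T3 := ((T2.comp tendsto_neg_atTop_atBot).comp
    (tendsto_fst (f := (atTop : Filter ℝ)) (g := (atTop : Filter ℝ)))).sub
    (T1.comp (tendsto_snd (f := (atTop : Filter ℝ)) (g := (atTop : Filter ℝ))))
  have T4 := T3.const_add (loopIntegral g c R)
  rw [sub_zero, add_zero] at T4
  refine T4.congr' ?_
  filter_upwards [(eventually_ge_atTop R).prod_mk (eventually_ge_atTop R)] with w hw
  obtain ⟨hw1, hw2⟩ := hw
  have hdU : DifferentiableOn ℂ g (Ici c ×ℂ uIcc R w.2) := hd.mono fun s hs => by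
    rw [uIcc_of_le hw2] at hs
    exact ⟨hs.1, hRa _ hs.2.1⟩
  have hdL : DifferentiableOn ℂ g (Ici c ×ℂ uIcc (-w.1) (-R)) := hd.mono fun s hs => by
    rw [uIcc_of_le (neg_le_neg hw1)] at hs
    exact ⟨hs.1, hRb _ hs.2.2⟩
  have e1 := integral_halfStrip hdU hh h0 fun t ht y hy => hb t ht y (by
    rw [uIcc_of_le hw2] at hy
    exact hRa _ hy.1)
  have e2 := integral_halfStrip hdL hh h0 fun t ht y hy => hb t ht y (by
    rw [uIcc_of_le (neg_le_neg hw1)] at hy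
    exact hRb _ hy.2)
  have hii : ∀ p q : ℝ, IntervalIntegrable (fun t : ℝ => g (c + t * Complex.I) * Complex.I)
      volume p q := fun p q => (hv.mul continuous_const).intervalIntegrable p q
  have e3 := intervalIntegral.integral_add_adjacent_intervals (hii (-w.1) (-R)) (hii (-R) R)
  have e4 := intervalIntegral.integral_add_adjacent_intervals (hii (-w.1) R) (hii R w.2)
  rw [← e4, ← e3, ← e1, ← e2, loopIntegral]
  simp only [Function.comp_apply, Complex.ofReal_neg, neg_mul, ← sub_eq_add_neg]
  ring

/-- The loop integral does not change when its vertical part is moved. -/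
theorem loopIntegral_eq_of_le {g : ℂ → ℂ} {c c' R : ℝ} (hcc : c ≤ c')
    (hd : DifferentiableOn ℂ g (Icc c c' ×ℂ uIcc (-R) R))
    (hi1 : IntegrableOn (fun t : ℝ => g (t - R * Complex.I)) (Ioi c))
    (hi2 : IntegrableOn (fun t : ℝ => g (t + R * Complex.I)) (Ioi c)) :
    loopIntegral g c R = loopIntegral g c' R := by
  have e1 := intervalIntegral.integral_interval_add_Ioi hi1
    (hi1.mono_set (Ioi_subset_Ioi hcc))
  have e2 := intervalIntegral.integral_interval_add_Ioi hi2
    (hi2.mono_set (Ioi_subset_Ioi hcc))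
  have hr := Complex.integral_boundary_rect_eq_zero_of_differentiableOn g
    (c + (-R : ℝ) * Complex.I) (c' + R * Complex.I) (hd.mono ?_)
  · simp only [Complex.add_re, Complex.ofReal_re, Complex.mul_re,
      Complex.I_re, Complex.ofReal_im, Complex.I_im, Complex.add_im, Complex.mul_im, mul_zero,
      mul_one, sub_zero, zero_add, add_zero] at hr
    simp only [Complex.ofReal_neg, neg_mul, ← sub_eq_add_neg, smul_eq_mul] at hr
    rw [loopIntegral, loopIntegral, intervalIntegral.integral_mul_const,
      intervalIntegral.integral_mul_const]
    linear_combination e1 - e2 - hr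
  · simp only [Complex.add_re, Complex.ofReal_re, Complex.mul_re,
      Complex.I_re, Complex.ofReal_im, Complex.I_im, Complex.add_im, Complex.mul_im, mul_zero,
      mul_one, sub_zero, zero_add, add_zero]
    rw [uIcc_of_le hcc]

/-- A vertical integral closed to the left is zero. -/
lemma tendsto_integral_vertical_zero {g : ℂ → ℂ} {c : ℝ} {h : ℝ → ℝ}
    (hd : DifferentiableOn ℂ g {s | s.re ≤ c})
    (hh : IntegrableOn h (Ioi (-c))) (h0 : Tendsto h atTop (𝓝 0))
    (hb : ∀ s : ℂ, s.re < c → ‖g s‖ ≤ h (-s.re))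
    (htop : ∀ t, -c < t → Tendsto (fun y : ℝ => g (-(t + y * Complex.I))) atTop (𝓝 0))
    (hbot : ∀ t, -c < t → Tendsto (fun y : ℝ => g (-(t + y * Complex.I))) atBot (𝓝 0)) :
    Tendsto (fun T : ℝ => ∫ t in (-T)..T, g (c + t * Complex.I) * Complex.I) atTop (𝓝 0) := by
  let f : ℂ → ℂ := fun s => g (-s)
  have hdf : DifferentiableOn ℂ f {s | -c ≤ s.re} :=
    hd.comp differentiable_neg.differentiableOn fun s hs => by
      simp only [mem_ofPred_eq, Complex.neg_re] at hs ⊢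
      linarith
  have hbf : ∀ t, -c < t → ∀ y : ℝ, ‖f (t + y * Complex.I)‖ ≤ h t := fun t ht y => by
    have := hb (-(t + y * Complex.I)) (by simp; linarith)
    rwa [show -(-((t : ℂ) + y * Complex.I)).re = t by simp] at this
  have hcf : ∀ y : ℝ, ContinuousOn (fun t : ℝ => f (t + y * Complex.I)) (Ioi (-c)) := fun y =>
    continuousOn_horizontal (R := 0) (hdf.mono fun s hs => hs.1) (abs_nonneg y)
  have T1 := tendsto_integral_horizontal (g := f) (Eventually.of_forall hcf) hh
    (Eventually.of_forall fun y t ht => hbf t ht y) htop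
  have T2 := tendsto_integral_horizontal (g := f) (Eventually.of_forall hcf) hh
    (Eventually.of_forall fun y t ht => hbf t ht y) hbot
  have T3 := (T2.comp tendsto_neg_atTop_atBot).sub T1
  rw [sub_zero] at T3
  refine T3.congr fun T => ?_
  have e := integral_halfStrip (g := f) (c := -c) (y₁ := -T) (y₂ := T)
    (hdf.mono fun s hs => hs.1) hh h0 fun t ht y _ => hbf t ht y
  have e2 := intervalIntegral.integral_comp_neg (a := -T) (b := T)
    fun t : ℝ => g (c + t * Complex.I) * Complex.I
  rw [neg_neg] at e2
  rw [← e2, Function.comp_apply, e]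
  refine intervalIntegral.integral_congr fun y _ => ?_
  simp only [f]
  congr 2
  push_cast
  ring

/-! ### Cauchy transforms and Meijer integrals -/

lemma tendsto_norm_add_mul_I_sub_atTop (t : ℝ) (q : ℂ) :
    Tendsto (fun y : ℝ => ‖(t : ℂ) + y * Complex.I - q‖) atTop atTop := by
  refine tendsto_atTop_mono (f := fun y : ℝ => y + -q.im) (fun y => ?_)
    (tendsto_atTop_add_const_right _ _ tendsto_id)
  refine le_trans ?_ (Complex.abs_im_le_norm _)
  refine le_trans (le_of_eq ?_) (le_abs_self _)
  simp
  ring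

lemma tendsto_norm_add_mul_I_sub_atBot (t : ℝ) (q : ℂ) :
    Tendsto (fun y : ℝ => ‖(t : ℂ) + y * Complex.I - q‖) atBot atTop := by
  refine tendsto_atTop_mono (f := fun y : ℝ => -y + q.im) (fun y => ?_)
    (tendsto_atTop_add_const_right _ _ tendsto_neg_atBot_atTop)
  refine le_trans ?_ (Complex.abs_im_le_norm _)
  refine le_trans (le_of_eq ?_) (neg_le_abs _)
  simp
  ring

lemma tendsto_zero_of_norm_le_rpow {l : Filter ℝ} {f : ℝ → ℂ} {N : ℝ → ℝ} {C ρ : ℝ} (hρ : 0 < ρ)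
    (hN : Tendsto N l atTop) (hb : ∀ᶠ y in l, ‖f y‖ ≤ C * N y ^ (-ρ)) : Tendsto f l (𝓝 0) := by
  have h1 := ((tendsto_rpow_neg_atTop hρ).comp hN).const_mul C
  rw [mul_zero] at h1
  exact squeeze_zero_norm' hb h1

/-- In a bound by `‖b - s‖ ^ (-ρ)` away from `b`, the centre can be changed to any `q`. -/
lemma exists_norm_le_rpow_of_center {F : ℂ → ℂ} {D : Set ℂ} {b q : ℂ} {ε C ρ : ℝ} (hε : 0 < ε)
    (hρ : 0 ≤ ρ) (hC : 0 < C) (hD : ∀ s ∈ D, ε ≤ ‖b - s‖)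
    (hF : ∀ s ∈ D, ‖F s‖ ≤ C * ‖b - s‖ ^ (-ρ)) :
    ∃ C' : ℝ, 0 < C' ∧ ∀ s ∈ D, s ≠ q → ‖F s‖ ≤ C' * ‖s - q‖ ^ (-ρ) := by
  have hκ : 0 < 1 + ‖b - q‖ / ε := by positivity
  refine ⟨C * (1 + ‖b - q‖ / ε) ^ ρ, by positivity, fun s hs hq => ?_⟩
  have h1 : 0 < ‖s - q‖ := norm_pos_iff.2 (sub_ne_zero.2 hq)
  have h2 : 0 < ‖b - s‖ := hε.trans_le (hD s hs)
  have h3 : ‖s - q‖ ≤ (1 + ‖b - q‖ / ε) * ‖b - s‖ := by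
    have h4 : ‖s - q‖ ≤ ‖b - q‖ + ‖b - s‖ := by
      have := norm_sub_le (b - q) (b - s)
      rwa [show b - q - (b - s) = s - q by ring] at this
    have h5 : ‖b - q‖ ≤ ‖b - q‖ / ε * ‖b - s‖ := by
      rw [div_mul_eq_mul_div, le_div_iff₀ hε]
      gcongr
      exact hD s hs
    linarith
  refine (hF s hs).trans ?_
  rw [mul_assoc]
  gcongr
  rw [Real.rpow_neg h2.le, Real.rpow_neg h1.le, ← div_eq_mul_inv, le_div_iff₀ (by positivity),
    inv_mul_le_iff₀ (by positivity), mul_comm, ← Real.mul_rpow hκ.le h2.le]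
  gcongr

lemma tendsto_integral_poisson {a : ℝ} (ha : 0 < a) (y₀ : ℝ) :
    Tendsto (fun T : ℝ => ∫ y in (-T)..T, 2 * a / (a ^ 2 + (y - y₀) ^ 2)) atTop (𝓝 (2 * π)) := by
  have hint : ∀ T : ℝ, ∫ y in (-T)..T, 2 * a / (a ^ 2 + (y - y₀) ^ 2) =
      2 * Real.arctan ((T - y₀) / a) - 2 * Real.arctan ((-T - y₀) / a) := by
    intro T
    refine intervalIntegral.integral_eq_sub_of_hasDerivAt
      (f := fun y => 2 * Real.arctan ((y - y₀) / a)) (fun y _ => ?_) ?_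
    · have h1 : HasDerivAt (fun y : ℝ => (y - y₀) / a) (1 / a) y :=
        ((hasDerivAt_id y).sub_const y₀).div_const a
      refine (h1.arctan.const_mul 2).congr_deriv ?_
      field_simp
    · refine Continuous.intervalIntegrable ?_ _ _
      refine continuous_const.div (by fun_prop) fun y => ?_
      positivity
  simp only [hint]
  have t1 : Tendsto (fun T : ℝ => (T - y₀) / a) atTop atTop :=
    (tendsto_atTop_add_const_right _ (-y₀) tendsto_id).atTop_div_const ha
  have t2 : Tendsto (fun T : ℝ => (-T - y₀) / a) atTop atBot :=
    (tendsto_atBot_add_const_right _ (-y₀) tendsto_neg_atTop_atBot).atBot_div_const ha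
  have t3 := (((Real.tendsto_arctan_atTop.mono_right nhdsWithin_le_nhds).comp t1).const_mul 2).sub
    (((Real.tendsto_arctan_atBot.mono_right nhdsWithin_le_nhds).comp t2).const_mul 2)
  rw [show 2 * (π / 2) - 2 * (-(π / 2)) = 2 * π by ring] at t3
  exact t3

lemma norm_div_sub_le_rpow {x : ℂ} {q s : ℂ} {C : ℝ} (hq : s ≠ q)
    (h : ‖x‖ ≤ C * ‖s - q‖ ^ (-(1 / 2) : ℝ)) : ‖x / (s - q)‖ ≤ C * ‖s - q‖ ^ (-(3 / 2) : ℝ) := by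
  have h1 : 0 < ‖s - q‖ := norm_pos_iff.2 (sub_ne_zero.2 hq)
  rw [norm_div, div_le_iff₀ h1, mul_assoc, ← Real.rpow_add_one h1.ne']
  norm_num at h ⊢
  exact h

lemma sub_ne_zero_of_re_lt {s q : ℂ} (h : q.re < s.re) : s ≠ q := fun e => by simp [e] at h

lemma norm_rpow_neg_le_of_re {s q : ℂ} {ρ : ℝ} (hρ : 0 ≤ ρ) (h : q.re < s.re) :
    ‖s - q‖ ^ (-ρ) ≤ (s.re - q.re) ^ (-ρ) :=
  Real.rpow_le_rpow_of_nonpos (sub_pos.2 h) (Complex.re_le_norm (s - q)) (by linarith)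

/-- The Cauchy transform of `F` over a vertical line, computed by residues to the left. The
subtracted `F s₀ * (1 / (s - s₀) + 1 / (m - s))`, with `m` the mirror image of `s₀` in the line,
removes the pole and restricts to the Poisson kernel on the line. -/
theorem tendsto_integral_vertical_div_sub {F : ℂ → ℂ} {b c ε C : ℝ} {s₀ : ℂ} (hcb : c < b)
    (hs₀ : s₀.re < c) (hε : 0 < ε) (hC : 0 < C) (hcε : ε ≤ b - c)
    (hd : DifferentiableOn ℂ F {s | s.re < b})
    (hF : ∀ s : ℂ, (ε ≤ (b - s).re ∨ ε ≤ |((b : ℂ) - s).im|) →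
      ‖F s‖ ≤ C * ‖b - s‖ ^ (-(1 / 2) : ℝ)) :
    Tendsto (fun T : ℝ => ∫ t in (-T)..T,
      F (c + t * Complex.I) / (c + t * Complex.I - s₀) * Complex.I) atTop
      (𝓝 (2 * π * Complex.I * F s₀)) := by
  set a := c - s₀.re with ha
  have ha0 : 0 < a := sub_pos.2 hs₀
  set m : ℂ := ((2 * c - s₀.re : ℝ) : ℂ) + s₀.im * Complex.I with hm
  have hmre : m.re = c + a := by simp [hm, ha]; ring
  have hopen : IsOpen {s : ℂ | s.re < b} := isOpen_lt Complex.continuous_re continuous_const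
  have hmem : {s : ℂ | s.re < b} ∈ 𝓝 s₀ := hopen.mem_nhds (hs₀.trans hcb)
  have hlt : ∀ s : ℂ, s.re ≤ c → s.re < m.re := fun s hs => by rw [hmre]; linarith
  have hms : ∀ s : ℂ, s.re ≤ c → m - s ≠ 0 := fun s hs =>
    sub_ne_zero.2 (sub_ne_zero_of_re_lt (hlt s hs))
  let G : ℂ → ℂ := fun s => dslope F s₀ s - F s₀ / (m - s)
  have hGd : DifferentiableOn ℂ G {s | s.re ≤ c} := by
    refine DifferentiableOn.sub ?_ ?_
    · exact ((Complex.differentiableOn_dslope hmem).2 hd).mono fun s hs => lt_of_le_of_lt hs hcb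
    · exact (differentiableOn_const _).div (by fun_prop) hms
  have hGs : ∀ s, s ≠ s₀ → s.re ≤ c →
      G s = F s / (s - s₀) - F s₀ * ((m - s₀) / ((s - s₀) * (m - s))) := by
    intro s hs hsc
    have h1 := sub_ne_zero.2 hs
    have h2 := hms s hsc
    simp only [G]
    rw [dslope_of_ne _ hs, slope_def_field]
    field_simp
    ring
  obtain ⟨C', hC', hFm⟩ := exists_norm_le_rpow_of_center (q := m) (D := {s : ℂ | s.re ≤ c}) hε
    (by norm_num : (0 : ℝ) ≤ 1 / 2) hC
    (fun s hs => le_norm_of_le_re_or_le_abs_im (Or.inl (by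
      simp only [mem_ofPred_eq] at hs
      simp
      linarith)))
    (fun s hs => hF s (Or.inl (by
      simp only [mem_ofPred_eq] at hs
      simp
      linarith)))
  -- the remainder decays like `‖s - m‖ ^ (-3 / 2)` on the whole half-plane
  obtain ⟨K, hK⟩ : ∃ K : ℝ, ∀ s : ℂ, s.re ≤ c → ‖G s‖ ≤ K * ‖s - m‖ ^ (-(3 / 2) : ℝ) := by
    have hcomp : IsCompact (Metric.closedBall s₀ 1 ∩ {s : ℂ | s.re ≤ c}) :=
      (isCompact_closedBall s₀ 1).inter_right (isClosed_le Complex.continuous_re continuous_const)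
    obtain ⟨K₁, hK₁⟩ := hcomp.exists_bound_of_continuousOn
      (f := fun s => ‖G s‖ * ‖s - m‖ ^ (3 / 2 : ℝ))
      ((hGd.continuousOn.mono inter_subset_right).norm.mul
        (Continuous.continuousOn (by
          refine Continuous.rpow_const (by fun_prop) fun s => Or.inr (by norm_num))))
    set κ := 1 + ‖m - s₀‖ with hκ
    have hκ0 : 0 < κ := by positivity
    set K₂ := C' * κ + ‖F s₀‖ * ‖m - s₀‖ * κ * a ^ (-(1 / 2) : ℝ) with hK₂
    refine ⟨max K₁ K₂, fun s hs => ?_⟩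
    have hsm : 0 < ‖s - m‖ := by
      rw [norm_sub_rev]
      exact norm_pos_iff.2 (hms s hs)
    by_cases hball : s ∈ Metric.closedBall s₀ 1
    · have h1 := (le_abs_self _).trans (hK₁ s ⟨hball, hs⟩)
      have h2 : ‖G s‖ ≤ K₁ * ‖s - m‖ ^ (-(3 / 2) : ℝ) := by
        rwa [Real.rpow_neg hsm.le, ← div_eq_mul_inv, le_div_iff₀ (by positivity)]
      refine h2.trans ?_
      gcongr
      exact le_max_left _ _
    · rw [Metric.mem_closedBall, dist_eq_norm, not_le] at hball
      have hne : s ≠ s₀ := by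
        rintro rfl
        simp at hball
        linarith
      have hss : 0 < ‖s - s₀‖ := by linarith
      have h1 : ‖s - m‖ ≤ κ * ‖s - s₀‖ := by
        have h2 := norm_sub_le (s - s₀) (m - s₀)
        rw [show s - s₀ - (m - s₀) = s - m by ring] at h2
        have h3 : ‖m - s₀‖ ≤ ‖m - s₀‖ * ‖s - s₀‖ := le_mul_of_one_le_right (norm_nonneg _) hball.le
        rw [hκ]
        linarith
      have h2 : ‖s - s₀‖⁻¹ ≤ κ * ‖s - m‖⁻¹ := by
        rw [← div_eq_mul_inv, inv_le_comm₀ hss (by positivity), inv_div, div_le_iff₀ hκ0]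
        linarith
      have h3 : ‖F s‖ ≤ C' * ‖s - m‖ ^ (-(1 / 2) : ℝ) :=
        hFm s hs (sub_ne_zero_of_re_lt (hlt s hs)).symm
      have e1 : ‖s - m‖ ^ (-(3 / 2) : ℝ) = ‖s - m‖ ^ (-(1 / 2) : ℝ) * ‖s - m‖⁻¹ := by
        rw [← Real.rpow_neg_one, ← Real.rpow_add hsm]
        norm_num
      have e2 : ‖s - m‖⁻¹ ≤ a ^ (-(1 / 2) : ℝ) * ‖s - m‖ ^ (-(1 / 2) : ℝ) := by
        have h4 : a ≤ ‖s - m‖ := by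
          rw [norm_sub_rev]
          refine le_trans ?_ (Complex.re_le_norm _)
          rw [Complex.sub_re, hmre]
          linarith
        have h5 : ‖s - m‖⁻¹ = ‖s - m‖ ^ (-(1 / 2) : ℝ) * ‖s - m‖ ^ (-(1 / 2) : ℝ) := by
          rw [← Real.rpow_neg_one, ← Real.rpow_add hsm]
          norm_num
        rw [h5]
        gcongr ?_ * _
        exact Real.rpow_le_rpow_of_nonpos ha0 h4 (by norm_num)
      have h6 : ‖G s‖ ≤ K₂ * ‖s - m‖ ^ (-(3 / 2) : ℝ) := by
        rw [hGs s hne hs]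
        refine (norm_sub_le _ _).trans ?_
        rw [norm_div, norm_mul, norm_div, norm_mul, norm_sub_rev m s, div_eq_mul_inv,
          div_eq_mul_inv, mul_inv, e1]
        calc ‖F s‖ * ‖s - s₀‖⁻¹ + ‖F s₀‖ * (‖m - s₀‖ * (‖s - s₀‖⁻¹ * ‖s - m‖⁻¹))
            ≤ (C' * ‖s - m‖ ^ (-(1 / 2) : ℝ)) * (κ * ‖s - m‖⁻¹) +
              ‖F s₀‖ * (‖m - s₀‖ * ((κ * ‖s - m‖⁻¹) *
                (a ^ (-(1 / 2) : ℝ) * ‖s - m‖ ^ (-(1 / 2) : ℝ)))) := by gcongr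
          _ = _ := by rw [hK₂]; ring
      refine h6.trans ?_
      gcongr
      exact le_max_right _ _
  have hGlim : ∀ (l : Filter ℝ) (t : ℝ), -c < t →
      Tendsto (fun y : ℝ => ‖(t : ℂ) + y * Complex.I - (-m)‖) l atTop →
      Tendsto (fun y : ℝ => G (-(t + y * Complex.I))) l (𝓝 0) := by
    intro l t ht hl
    refine tendsto_zero_of_norm_le_rpow (C := K) (ρ := 3 / 2) (by norm_num) hl
      (Eventually.of_forall fun y => ?_)
    have := hK (-(t + y * Complex.I)) (by simp; linarith)
    rwa [show -((t : ℂ) + y * Complex.I) - m = -((t : ℂ) + y * Complex.I - -m) by ring,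
      norm_neg] at this
  have hK0 : 0 ≤ K := by
    have h1 := (norm_nonneg _).trans (hK s₀ hs₀.le)
    have h2 : 0 < ‖s₀ - m‖ := by
      rw [norm_sub_rev]
      exact norm_pos_iff.2 (hms s₀ hs₀.le)
    exact nonneg_of_mul_nonneg_left h1 (by positivity)
  have hG0 : Tendsto (fun T : ℝ => ∫ t in (-T)..T, G (c + t * Complex.I) * Complex.I) atTop
      (𝓝 0) := by
    refine tendsto_integral_vertical_zero (h := fun t => K * (t + m.re) ^ (-(3 / 2) : ℝ)) hGd
      ((integrableOn_add_rpow_Ioi_of_lt (by norm_num) (by rw [hmre]; linarith)).const_mul K) ?_ ?_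
      (fun t ht => hGlim _ t ht (tendsto_norm_add_mul_I_sub_atTop t _))
      (fun t ht => hGlim _ t ht (tendsto_norm_add_mul_I_sub_atBot t _))
    · have := ((tendsto_rpow_neg_atTop (by norm_num : (0 : ℝ) < 3 / 2)).comp
        (tendsto_atTop_add_const_right _ m.re tendsto_id)).const_mul K
      rw [mul_zero] at this
      exact this
    · intro s hs
      refine (hK s hs.le).trans ?_
      have := norm_rpow_neg_le_of_re (ρ := 3 / 2) (by norm_num) (hlt s hs.le)
      rw [norm_sub_rev, show m.re - s.re = -s.re + m.re by ring] at this
      gcongr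
  have hP := ((Complex.continuous_ofReal.tendsto _).comp
    (tendsto_integral_poisson ha0 s₀.im)).mul_const (Complex.I * F s₀)
  have hsum := hG0.add hP
  rw [zero_add, show ((2 * π : ℝ) : ℂ) * (Complex.I * F s₀) = 2 * π * Complex.I * F s₀ by
    push_cast; ring] at hsum
  refine hsum.congr fun T => ?_
  have hcG : Continuous fun t : ℝ => G (c + t * Complex.I) * Complex.I := by
    refine Continuous.mul ?_ continuous_const
    exact hGd.continuousOn.comp_continuous (by fun_prop) fun t => by simp
  have hcP : Continuous fun y : ℝ => ((2 * a / (a ^ 2 + (y - s₀.im) ^ 2) : ℝ) : ℂ) *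
      (Complex.I * F s₀) := by
    refine Continuous.mul (Complex.continuous_ofReal.comp ?_) continuous_const
    refine continuous_const.div (by fun_prop) fun y => ?_
    positivity
  rw [Function.comp_apply, ← intervalIntegral.integral_ofReal,
    ← intervalIntegral.integral_mul_const, ← intervalIntegral.integral_add
    (hcG.intervalIntegrable _ _) (hcP.intervalIntegrable _ _)]
  refine intervalIntegral.integral_congr fun y _ => ?_
  have hre : ((c : ℂ) + y * Complex.I).re = c := by simp
  have hne : (c : ℂ) + y * Complex.I ≠ s₀ := sub_ne_zero_of_re_lt (by rw [hre]; exact hs₀)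
  have hGy := hGs _ hne hre.le
  have h1 : (c : ℂ) + y * Complex.I - s₀ = a + (y - s₀.im) * Complex.I := by
    apply Complex.ext <;> simp [ha]
  have h2 : m - ((c : ℂ) + y * Complex.I) = a - (y - s₀.im) * Complex.I := by
    apply Complex.ext <;> simp [hm, ha] ; ring
  have h3 : m - s₀ = 2 * a := by
    apply Complex.ext <;> simp [hm, ha] ; ring
  have h4 : ((c : ℂ) + y * Complex.I - s₀) * (m - ((c : ℂ) + y * Complex.I)) =
      ((a ^ 2 + (y - s₀.im) ^ 2 : ℝ) : ℂ) := by
    rw [h1, h2]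
    push_cast
    linear_combination -((y : ℂ) - s₀.im) ^ 2 * Complex.I_sq
  rw [hGy, h4, h3]
  push_cast
  ring

/-- The region in which the Gamma quotient with poles on `[b, ∞)` is analytic. -/
def slitRegion (b : ℝ) : Set ℂ := {s | s.re < b ∨ s.im ≠ 0}

/-- `F` is analytic off the ray `[b, ∞)`, and `O(‖b - s‖ ^ (-1 / 2))` at a positive distance from
the ray. -/
structure IsSlitDecaying (F : ℂ → ℂ) (b : ℝ) : Prop where
  differentiableOn : DifferentiableOn ℂ F (slitRegion b)
  norm_le : ∀ ε : ℝ, 0 < ε → ∃ C : ℝ, 0 < C ∧ ∀ s : ℂ,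
    (ε ≤ (b - s).re ∨ ε ≤ |((b : ℂ) - s).im|) → ‖F s‖ ≤ C * ‖b - s‖ ^ (-(1 / 2) : ℝ)

lemma IsSlitDecaying.exists_norm_le {F : ℂ → ℂ} {b ε : ℝ} (hF : IsSlitDecaying F b) (hε : 0 < ε)
    (q : ℂ) : ∃ C : ℝ, 0 < C ∧ ∀ s : ℂ, (s.re ≤ b - ε ∨ ε ≤ |s.im|) → s ≠ q →
      ‖F s‖ ≤ C * ‖s - q‖ ^ (-(1 / 2) : ℝ) := by
  obtain ⟨C, hC, h⟩ := hF.norm_le ε hε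
  have hD : ∀ s : ℂ, (s.re ≤ b - ε ∨ ε ≤ |s.im|) → (ε ≤ (b - s).re ∨ ε ≤ |((b : ℂ) - s).im|) := by
    intro s hs
    refine hs.imp (fun h => ?_) (fun h => ?_)
    · simp
      linarith
    · simpa using h
  exact exists_norm_le_rpow_of_center (D := {s : ℂ | s.re ≤ b - ε ∨ ε ≤ |s.im|}) hε (by norm_num) hC
    (fun s hs => le_norm_of_le_re_or_le_abs_im (hD s hs)) (fun s hs => h s (hD s hs))

lemma continuous_vertical {g : ℂ → ℂ} {b c : ℝ} (hd : DifferentiableOn ℂ g (slitRegion b))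
    (hcb : c < b) : Continuous fun y : ℝ => g (c + y * Complex.I) :=
  hd.continuousOn.comp_continuous (by fun_prop) fun y => Or.inl (by simpa using hcb)

lemma subset_slitRegion (b c : ℝ) {R : ℝ} (hR : 0 < R) :
    {s : ℂ | c ≤ s.re ∧ R ≤ |s.im|} ⊆ slitRegion b := fun _ hs =>
  Or.inr (abs_pos.1 (hR.trans_le hs.2))

lemma IsSlitDecaying.exists_norm_div_sub_le {F : ℂ → ℂ} {b c R : ℝ} {s₀ : ℂ}
    (hF : IsSlitDecaying F b) (hs₀ : s₀.re < c) (hR : 0 < R) :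
    ∃ C : ℝ, 0 < C ∧ (∀ t, c < t → ∀ y : ℝ, R ≤ |y| → ‖F (t + y * Complex.I) /
      (t + y * Complex.I - s₀)‖ ≤ C * ‖(t : ℂ) + y * Complex.I - s₀‖ ^ (-(3 / 2) : ℝ)) ∧
      ∀ t, c < t → ∀ y : ℝ, R ≤ |y| → ‖F (t + y * Complex.I) /
      (t + y * Complex.I - s₀)‖ ≤ C * (t + -s₀.re) ^ (-(3 / 2) : ℝ) := by
  obtain ⟨C, hC, h⟩ := hF.exists_norm_le hR s₀
  have h1 : ∀ t, c < t → ∀ y : ℝ, s₀.re < ((t : ℂ) + y * Complex.I).re := fun t ht y => by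
    simp
    linarith
  have h2 : ∀ t, c < t → ∀ y : ℝ, R ≤ |y| → ‖F (t + y * Complex.I) / (t + y * Complex.I - s₀)‖ ≤
      C * ‖(t : ℂ) + y * Complex.I - s₀‖ ^ (-(3 / 2) : ℝ) := fun t ht y hy =>
    norm_div_sub_le_rpow (sub_ne_zero_of_re_lt (h1 t ht y))
      (h _ (Or.inr (by simpa using hy)) (sub_ne_zero_of_re_lt (h1 t ht y)))
  refine ⟨C, hC, h2, fun t ht y hy => (h2 t ht y hy).trans ?_⟩
  have := norm_rpow_neg_le_of_re (ρ := 3 / 2) (by norm_num) (h1 t ht y)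
  rw [show ((t : ℂ) + y * Complex.I).re - s₀.re = t + -s₀.re by simp; ring] at this
  gcongr

lemma integrableOn_const_mul_add_rpow {c x C : ℝ} (hx : x < c) :
    IntegrableOn (fun t : ℝ => C * (t + -x) ^ (-(3 / 2) : ℝ)) (Ioi c) :=
  (integrableOn_add_rpow_Ioi_of_lt (by norm_num) (by simpa using hx)).const_mul C

/-- Cauchy's formula for the loop: the point `s₀` lies outside it, to the left. -/
theorem IsSlitDecaying.loopIntegral_div_sub {F : ℂ → ℂ} {b c R : ℝ} {s₀ : ℂ}
    (hF : IsSlitDecaying F b) (hcb : c < b) (hs₀ : s₀.re < c) (hR : 0 < R) :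
    loopIntegral (fun s => F s / (s - s₀)) c R = 2 * π * Complex.I * F s₀ := by
  obtain ⟨C, hC, h1, h2⟩ := hF.exists_norm_div_sub_le hs₀ hR
  have hne : ∀ s : ℂ, c ≤ s.re → s - s₀ ≠ 0 := fun s hs =>
    sub_ne_zero.2 (sub_ne_zero_of_re_lt (hs₀.trans_le hs))
  have hlim : ∀ (l : Filter ℝ) (t : ℝ), c < t → (∀ᶠ y in l, R ≤ |y|) →
      Tendsto (fun y : ℝ => ‖(t : ℂ) + y * Complex.I - s₀‖) l atTop →
      Tendsto (fun y : ℝ => F (t + y * Complex.I) / (t + y * Complex.I - s₀)) l (𝓝 0) :=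
    fun l t ht hy hl => tendsto_zero_of_norm_le_rpow (by norm_num : (0 : ℝ) < 3 / 2) hl
      (hy.mono fun y hy => h1 t ht y hy)
  have T1 := tendsto_integral_vertical_loopIntegral (g := fun s => F s / (s - s₀)) (c := c) (R := R)
    (h := fun t => C * (t + -s₀.re) ^ (-(3 / 2) : ℝ))
    ((hF.differentiableOn.mono (subset_slitRegion b c hR)).div (by fun_prop) fun s hs => hne s hs.1)
    ((continuous_vertical hF.differentiableOn hcb).div (by fun_prop) fun y => hne _ (by simp))
    (integrableOn_const_mul_add_rpow hs₀)
    (by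
      have := ((tendsto_rpow_neg_atTop (by norm_num : (0 : ℝ) < 3 / 2)).comp
        (tendsto_atTop_add_const_right _ (-s₀.re) tendsto_id)).const_mul C
      rw [mul_zero] at this
      exact this)
    (fun t ht y hy => h2 t ht y hy)
    (fun t ht => hlim _ t ht ((eventually_ge_atTop R).mono fun y hy => hy.trans (le_abs_self y))
      (tendsto_norm_add_mul_I_sub_atTop t _))
    (fun t ht => hlim _ t ht ((eventually_le_atBot (-R)).mono fun y hy =>
      (le_neg.2 hy).trans (neg_le_abs y)) (tendsto_norm_add_mul_I_sub_atBot t _))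
  have T2 : Tendsto (fun T : ℝ => (T, T)) atTop (atTop ×ˢ atTop) := tendsto_id.prodMk tendsto_id
  obtain ⟨C', hC', hb⟩ := hF.norm_le (b - c) (sub_pos.2 hcb)
  exact tendsto_nhds_unique (T1.comp T2) (tendsto_integral_vertical_div_sub hcb hs₀
    (sub_pos.2 hcb) hC' le_rfl (hF.differentiableOn.mono fun s hs => Or.inl hs) hb)

lemma norm_ofReal_cpow_add_mul_I {z : ℝ} (hz : 0 < z) (t y : ℝ) :
    ‖(z : ℂ) ^ ((t : ℂ) + y * Complex.I)‖ = z ^ t := by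
  rw [Complex.norm_cpow_eq_rpow_re_of_pos hz]
  simp

lemma integrableOn_rpow_const_Ioi {z : ℝ} (hz : 0 < z) (hz1 : z < 1) (c : ℝ) :
    IntegrableOn (fun t : ℝ => z ^ t) (Ioi c) := by
  have h := integrableOn_exp_mul_Ioi (Real.log_neg hz hz1) c
  refine h.congr_fun (fun t _ => ?_) measurableSet_Ioi
  rw [Real.rpow_def_of_pos hz]

lemma IsSlitDecaying.exists_norm_mul_cpow_le {F : ℂ → ℂ} {b R z : ℝ}
    (hF : IsSlitDecaying F b) (hR : 0 < R) (hz : 0 < z) :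
    ∃ C : ℝ, 0 < C ∧ (∀ t y : ℝ, R ≤ |y| → ‖F (t + y * Complex.I) *
      (z : ℂ) ^ ((t : ℂ) + y * Complex.I)‖ ≤
        C * z ^ t * ‖(t : ℂ) + y * Complex.I - b‖ ^ (-(1 / 2) : ℝ)) ∧
      ∀ t y : ℝ, R ≤ |y| → ‖F (t + y * Complex.I) * (z : ℂ) ^ ((t : ℂ) + y * Complex.I)‖ ≤
        C * R ^ (-(1 / 2) : ℝ) * z ^ t := by
  obtain ⟨C, hC, h⟩ := hF.exists_norm_le hR b
  have him : ∀ t y : ℝ, |y| ≤ ‖(t : ℂ) + y * Complex.I - b‖ := fun t y => by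
    have := Complex.abs_im_le_norm ((t : ℂ) + y * Complex.I - b)
    simpa using this
  have h1 : ∀ t y : ℝ, R ≤ |y| → ‖F (t + y * Complex.I) * (z : ℂ) ^ ((t : ℂ) + y * Complex.I)‖ ≤
        C * z ^ t * ‖(t : ℂ) + y * Complex.I - b‖ ^ (-(1 / 2) : ℝ) := fun t y hy => by
    have h2 := h (t + y * Complex.I) (Or.inr (by simpa using hy)) (by
      have := hR.trans_le (hy.trans (him t y))
      exact sub_ne_zero.1 (norm_pos_iff.1 this))
    rw [norm_mul, norm_ofReal_cpow_add_mul_I hz, mul_right_comm]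
    gcongr
  refine ⟨C, hC, h1, fun t y hy => (h1 t y hy).trans ?_⟩
  rw [mul_right_comm]
  gcongr C * ?_ * _
  exact Real.rpow_le_rpow_of_nonpos hR (hy.trans (him t y)) (by norm_num)

lemma differentiable_const_ofReal_cpow {z : ℝ} (hz : 0 < z) :
    Differentiable ℂ fun s : ℂ => (z : ℂ) ^ s := fun _ =>
  (differentiableAt_id).const_cpow (Or.inl (Complex.ofReal_ne_zero.2 hz.ne'))

theorem IsSlitDecaying.integrableOn_mul_cpow {F : ℂ → ℂ} {b c R z y : ℝ}
    (hF : IsSlitDecaying F b) (hR : 0 < R) (hz : 0 < z) (hz1 : z < 1) (hy : R ≤ |y|) :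
    IntegrableOn (fun t : ℝ => F (t + y * Complex.I) * (z : ℂ) ^ ((t : ℂ) + y * Complex.I))
      (Ioi c) := by
  obtain ⟨C, hC, h1, h2⟩ := hF.exists_norm_mul_cpow_le hR hz
  exact integrableOn_horizontal (g := fun s => F s * (z : ℂ) ^ s)
    (continuousOn_horizontal ((hF.differentiableOn.mono (subset_slitRegion b c hR)).mul
      (differentiable_const_ofReal_cpow hz).differentiableOn) hy)
    ((integrableOn_rpow_const_Ioi hz hz1 c).const_mul _) fun t _ => h2 t y hy

theorem IsSlitDecaying.tendsto_integral_vertical_mul_cpow {F : ℂ → ℂ} {b c R z : ℝ}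
    (hF : IsSlitDecaying F b) (hcb : c < b) (hR : 0 < R) (hz : 0 < z) (hz1 : z < 1) :
    Tendsto (fun w : ℝ × ℝ => ∫ t in (-w.1)..w.2, F (c + t * Complex.I) *
      (z : ℂ) ^ ((c : ℂ) + t * Complex.I) * Complex.I)
      (atTop ×ˢ atTop) (𝓝 (loopIntegral (fun s => F s * (z : ℂ) ^ s) c R)) := by
  obtain ⟨C, hC, h1, h2⟩ := hF.exists_norm_mul_cpow_le hR hz
  have hlim : ∀ (l : Filter ℝ) (t : ℝ), (∀ᶠ y in l, R ≤ |y|) →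
      Tendsto (fun y : ℝ => ‖(t : ℂ) + y * Complex.I - b‖) l atTop →
      Tendsto (fun y : ℝ => F (t + y * Complex.I) * (z : ℂ) ^ ((t : ℂ) + y * Complex.I)) l (𝓝 0) :=
    fun l t hy hl => tendsto_zero_of_norm_le_rpow (by norm_num : (0 : ℝ) < 1 / 2) hl
      (hy.mono fun y hy => h1 t y hy)
  have hdz := differentiable_const_ofReal_cpow hz
  refine tendsto_integral_vertical_loopIntegral (g := fun s => F s * (z : ℂ) ^ s)
    ((hF.differentiableOn.mono (subset_slitRegion b c hR)).mul hdz.differentiableOn)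
    (continuous_vertical (hF.differentiableOn.mul hdz.differentiableOn) hcb)
    ((integrableOn_rpow_const_Ioi hz hz1 c).const_mul _) ?_ (fun t _ y hy => h2 t y hy)
    (fun t _ => hlim _ t ((eventually_ge_atTop R).mono fun y hy => hy.trans (le_abs_self y))
      (tendsto_norm_add_mul_I_sub_atTop t _))
    (fun t _ => hlim _ t ((eventually_le_atBot (-R)).mono fun y hy =>
      (le_neg.2 hy).trans (neg_le_abs y)) (tendsto_norm_add_mul_I_sub_atBot t _))
  simpa using (tendsto_rpow_atTop_of_base_lt_one z (by linarith) hz1).const_mul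
    (C * R ^ (-(1 / 2) : ℝ))

/-- The Meijer integral does not depend on the loop. -/
theorem IsSlitDecaying.loopIntegral_mul_cpow_eq {F : ℂ → ℂ} {b c c' R R' z : ℝ}
    (hF : IsSlitDecaying F b) (hcb : c < b) (hcb' : c' < b) (hR : 0 < R) (hR' : 0 < R')
    (hz : 0 < z) (hz1 : z < 1) :
    loopIntegral (fun s => F s * (z : ℂ) ^ s) c R =
      loopIntegral (fun s => F s * (z : ℂ) ^ s) c' R' := by
  have hdz := differentiable_const_ofReal_cpow hz
  have key : ∀ c c' : ℝ, c ≤ c' → c < b → c' < b →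
      loopIntegral (fun s => F s * (z : ℂ) ^ s) c R =
        loopIntegral (fun s => F s * (z : ℂ) ^ s) c' R := by
    intro c c' hcc _ hcb'
    refine loopIntegral_eq_of_le hcc ((hF.differentiableOn.mul hdz.differentiableOn).mono
      fun s hs => Or.inl (lt_of_le_of_lt hs.1.2 hcb')) ?_ ?_
    · have := hF.integrableOn_mul_cpow (c := c) (y := -R) hR hz hz1 (by simp [abs_of_pos hR])
      simpa [← sub_eq_add_neg] using this
    · exact hF.integrableOn_mul_cpow hR hz hz1 (le_abs_self R)
  have hRR : loopIntegral (fun s => F s * (z : ℂ) ^ s) c' R =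
      loopIntegral (fun s => F s * (z : ℂ) ^ s) c' R' :=
    tendsto_nhds_unique (hF.tendsto_integral_vertical_mul_cpow hcb' hR hz hz1)
      (hF.tendsto_integral_vertical_mul_cpow hcb' hR' hz hz1)
  rw [← hRR]
  rcases le_total c c' with h | h
  · exact key c c' h hcb hcb'
  · exact (key c' c h hcb' hcb).symm

/-! ### Mellin transforms of loop integrals -/

lemma differentiableAt_gammaRatio {ι : Type*} [Fintype ι] (a b : ι → ℝ) {s : ℂ}
    (hs : ∀ j, s.re < b j ∨ s.im ≠ 0) : DifferentiableAt ℂ (gammaRatio a b) s := by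
  have h : gammaRatio a b = fun s => (∏ j, Complex.Gamma (b j - s)) *
      ∏ j, (Complex.Gamma (a j - s))⁻¹ := by
    funext s
    rw [gammaRatio, div_eq_mul_inv, Finset.prod_inv_distrib]
  rw [h]
  refine DifferentiableAt.mul ?_ ?_
  · refine DifferentiableAt.fun_finsetProd fun j _ => ?_
    refine DifferentiableAt.comp s (Complex.differentiableAt_Gamma _ fun n hn => ?_) (by fun_prop)
    have hre := congrArg Complex.re hn
    have him := congrArg Complex.im hn
    simp at hre him
    rcases hs j with h | h
    · have : (0 : ℝ) ≤ n := n.cast_nonneg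
      linarith
    · exact h him
  · refine DifferentiableAt.fun_finsetProd fun j _ => ?_
    exact (Complex.differentiable_one_div_Gamma _).comp s (by fun_prop)

lemma isSlitDecaying_gammaRatio {ι : Type*} [Fintype ι] (a b : ι → ℝ) {β : ℝ}
    (hβ : ∀ j, β ≤ b j) (hab : ∑ j, a j - ∑ j, b j = 1 / 2) :
    IsSlitDecaying (gammaRatio a b) β where
  differentiableOn := fun _ hs => (differentiableAt_gammaRatio a b fun j =>
    hs.imp_left fun h => lt_of_lt_of_le h (hβ j)).differentiableWithinAt
  norm_le := fun _ hε => norm_gammaRatio_le a b hε hβ hab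

lemma cpow_mul_div_pow_cpow {X x : ℝ} (hX : 0 < X) (hx : 0 < x) (l : ℕ) (τ s : ℂ) :
    (x : ℂ) ^ τ * ((x ^ l / X ^ l : ℝ) : ℂ) ^ s = (x : ℂ) ^ (τ + l * s) * (X : ℂ) ^ (-(l * s)) := by
  have hx0 : (x : ℂ) ≠ 0 := Complex.ofReal_ne_zero.2 hx.ne'
  have hX0 : (X : ℂ) ≠ 0 := Complex.ofReal_ne_zero.2 hX.ne'
  have hz : ((x ^ l / X ^ l : ℝ) : ℂ) ≠ 0 := Complex.ofReal_ne_zero.2 (by positivity)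
  have hL : Complex.log ((x ^ l / X ^ l : ℝ) : ℂ) = l * Complex.log x - l * Complex.log X := by
    rw [← Complex.ofReal_log (by positivity), ← Complex.ofReal_log hx.le,
      ← Complex.ofReal_log hX.le, Real.log_div (by positivity) (by positivity), Real.log_pow,
      Real.log_pow]
    push_cast
    rfl
  rw [Complex.cpow_def_of_ne_zero hz, Complex.cpow_def_of_ne_zero hx0,
    Complex.cpow_def_of_ne_zero hx0, Complex.cpow_def_of_ne_zero hX0, ← Complex.exp_add,
    ← Complex.exp_add, hL]
  ring_nf

lemma integrableOn_cpow_Ioo {X : ℝ} (hX : 0 < X) {τ : ℂ} (hτ : -1 < τ.re) :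
    IntegrableOn (fun x : ℝ => (x : ℂ) ^ τ) (Ioo 0 X) := by
  have h := intervalIntegral.intervalIntegrable_cpow' (a := 0) (b := X) hτ
  rw [intervalIntegrable_iff_integrableOn_Ioc_of_le hX.le] at h
  exact h.mono_set Ioo_subset_Ioc_self

/-- Fubini's theorem for the Mellin transform of a superposition of the powers
`(x ^ l / X ^ l) ^ γ(t)` on `(0, X)`. -/
theorem mellin_superposition {X : ℝ} (hX : 0 < X) (l : ℕ) (σ : ℂ) {μ : Measure ℝ} [SFinite μ]
    {γ f : ℝ → ℂ} (hγ : Measurable γ) (hf : AEStronglyMeasurable f μ)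
    (hpos : ∀ᵐ t ∂μ, 0 < (σ - 1 + l * γ t).re)
    (hint : Integrable (fun t => ‖f t‖ / (σ - 1 + l * γ t).re) μ) :
    IntegrableOn (fun x : ℝ => (x : ℂ) ^ (σ - 2) * ∫ t, f t * ((x ^ l / X ^ l : ℝ) : ℂ) ^ γ t ∂μ)
      (Ioo 0 X) ∧
    ∫ x in Ioo 0 X, (x : ℂ) ^ (σ - 2) * ∫ t, f t * ((x ^ l / X ^ l : ℝ) : ℂ) ^ γ t ∂μ =
      (X : ℂ) ^ (σ - 1) * ∫ t, f t / (σ - 1 + l * γ t) ∂μ := by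
  let k : ℝ × ℝ → ℂ := fun q =>
    (q.1 : ℂ) ^ (σ - 2) * (f q.2 * ((q.1 ^ l / X ^ l : ℝ) : ℂ) ^ γ q.2)
  have hkm : AEStronglyMeasurable k ((volume.restrict (Ioo 0 X)).prod μ) := by
    refine AEStronglyMeasurable.mul ?_ (AEStronglyMeasurable.mul (hf.comp_snd) ?_)
    · exact (Measurable.pow_const (by fun_prop) _).aestronglyMeasurable
    · exact (Measurable.pow (by fun_prop) (hγ.comp measurable_snd)).aestronglyMeasurable
  have hk : ∀ x ∈ Ioo 0 X, ∀ t, k (x, t) =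
      f t * (X : ℂ) ^ (-(l * γ t)) * (x : ℂ) ^ (σ - 2 + l * γ t) := fun x hx t => by
    have := cpow_mul_div_pow_cpow hX hx.1 l (σ - 2) (γ t)
    simp only [k]
    linear_combination f t * this
  have hre : ∀ t, (σ - 2 + l * γ t).re = (σ - 1 + l * γ t).re - 1 := fun t => by
    simp only [Complex.add_re, Complex.sub_re, Complex.one_re, Complex.re_ofNat]
    ring
  have hki : ∀ t, 0 < (σ - 1 + l * γ t).re → IntegrableOn (fun x => k (x, t)) (Ioo 0 X) :=
    fun t ht => IntegrableOn.congr_fun ((integrableOn_cpow_Ioo hX (τ := σ - 2 + l * γ t)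
      (by rw [hre]; linarith)).const_mul (f t * (X : ℂ) ^ (-(l * γ t))))
        (fun x hx => (hk x hx t).symm) measurableSet_Ioo
  have hkn : ∀ t, 0 < (σ - 1 + l * γ t).re → ∫ x in Ioo 0 X, ‖k (x, t)‖ =
      X ^ (σ.re - 1) * (‖f t‖ / (σ - 1 + l * γ t).re) := by
    intro t ht
    have e1 : ∀ x ∈ Ioo 0 X, ‖k (x, t)‖ =
        ‖f t‖ * X ^ (-(l * γ t).re) * x ^ ((σ - 1 + l * γ t).re - 1) := fun x hx => by
      rw [hk x hx, norm_mul, norm_mul, Complex.norm_cpow_eq_rpow_re_of_pos hX,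
        Complex.norm_cpow_eq_rpow_re_of_pos hx.1, hre, Complex.neg_re]
    rw [setIntegral_congr_fun measurableSet_Ioo e1, integral_const_mul,
      ← integral_Ioc_eq_integral_Ioo,
      ← intervalIntegral.integral_of_le hX.le, integral_rpow (Or.inl (by linarith)),
      sub_add_cancel, Real.zero_rpow ht.ne', sub_zero, mul_div_assoc', mul_div_assoc', mul_assoc,
      ← Real.rpow_add hX, mul_comm]
    congr 3
    simp
  have hK : Integrable k ((volume.restrict (Ioo 0 X)).prod μ) := by
    rw [integrable_prod_iff' hkm]
    refine ⟨hpos.mono fun t ht => hki t ht, (hint.const_mul (X ^ (σ.re - 1))).congr ?_⟩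
    exact hpos.mono fun t ht => (hkn t ht).symm
  have hinner : ∀ x : ℝ, (x : ℂ) ^ (σ - 2) * ∫ t, f t * ((x ^ l / X ^ l : ℝ) : ℂ) ^ γ t ∂μ =
      ∫ t, k (x, t) ∂μ := fun x => (integral_const_mul _ _).symm
  simp only [hinner]
  refine ⟨hK.integral_prod_left, ?_⟩
  rw [integral_integral_swap hK, ← integral_const_mul]
  refine integral_congr_ae (hpos.mono fun t ht => ?_)
  have hne : σ - 1 + l * γ t ≠ 0 := fun h => by simp [h] at ht
  have e2 : σ - 2 + l * γ t + 1 = σ - 1 + l * γ t := by ring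
  have hX0 : (X : ℂ) ≠ 0 := Complex.ofReal_ne_zero.2 hX.ne'
  simp only
  rw [setIntegral_congr_fun measurableSet_Ioo fun x hx => hk x hx t, integral_const_mul,
    ← integral_Ioc_eq_integral_Ioo, ← intervalIntegral.integral_of_le hX.le,
    integral_cpow (Or.inl (by rw [hre]; linarith)), e2, Complex.ofReal_zero,
    Complex.zero_cpow hne, sub_zero, mul_div_assoc', mul_assoc, ← Complex.cpow_add _ _ hX0]
  ring_nf

/-- The Mellin transform of the Meijer integral. -/
theorem IsSlitDecaying.mellin_loopIntegral {F : ℂ → ℂ} {b c R X : ℝ} (hF : IsSlitDecaying F b)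
    (hcb : c < b) (hR : 0 < R) (hX : 0 < X) {l : ℕ} (hl : l ≠ 0) {σ : ℂ}
    (hσ : ((1 - σ) / l).re < c) :
    IntegrableOn (fun x : ℝ => (x : ℂ) ^ (σ - 2) *
      loopIntegral (fun s => F s * ((x ^ l / X ^ l : ℝ) : ℂ) ^ s) c R) (Ioo 0 X) ∧
    ∫ x in Ioo 0 X, (x : ℂ) ^ (σ - 2) *
      loopIntegral (fun s => F s * ((x ^ l / X ^ l : ℝ) : ℂ) ^ s) c R =
      (X : ℂ) ^ (σ - 1) * (2 * π * Complex.I * F ((1 - σ) / l) / l) := by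
  set s₀ := (1 - σ) / (l : ℂ) with hs₀
  have hl0 : (0 : ℝ) < l := by positivity
  have hlC : (l : ℂ) ≠ 0 := Nat.cast_ne_zero.2 hl
  have hmul : ∀ s : ℂ, σ - 1 + l * s = l * (s - s₀) := fun s => by
    rw [hs₀]
    field_simp
    ring
  have hre : ∀ s : ℂ, (σ - 1 + l * s).re = l * (s.re - s₀.re) := fun s => by
    rw [hmul, ← Complex.ofReal_natCast, Complex.re_ofReal_mul, Complex.sub_re]
  have hor : ∀ y : ℝ, R ≤ |y| → _ := fun y hy =>
    mellin_superposition hX l σ (μ := volume.restrict (Ioi c)) (γ := fun t => t + y * Complex.I)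
      (f := fun t => F (t + y * Complex.I)) (by fun_prop)
      ((continuousOn_horizontal (hF.differentiableOn.mono (subset_slitRegion b c hR))
        hy).aestronglyMeasurable measurableSet_Ioi)
      ((ae_restrict_mem measurableSet_Ioi).mono fun t ht => by
        rw [mem_Ioi] at ht
        rw [hre]
        refine mul_pos hl0 ?_
        simp
        linarith)
      (by
        obtain ⟨C, hC, h⟩ := hF.exists_norm_le hR s₀
        refine Integrable.mono' (integrableOn_const_mul_add_rpow (C := C / l) hσ) ?_
          ((ae_restrict_mem measurableSet_Ioi).mono fun t ht => ?_)
        · refine ContinuousOn.aestronglyMeasurable (ContinuousOn.div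
            (continuousOn_horizontal (hF.differentiableOn.mono (subset_slitRegion b c hR)) hy).norm
            (by fun_prop) fun t ht => ?_) measurableSet_Ioi
          rw [mem_Ioi] at ht
          rw [hre]
          refine (mul_pos hl0 ?_).ne'
          simp
          linarith
        · rw [mem_Ioi] at ht
          have hlt : s₀.re < ((t : ℂ) + y * Complex.I).re := by simp; linarith
          have ht0 : 0 < t + -s₀.re := by linarith
          have h1 := (h (t + y * Complex.I) (Or.inr (by simpa using hy))
            (sub_ne_zero_of_re_lt hlt)).trans (mul_le_mul_of_nonneg_left
              (norm_rpow_neg_le_of_re (ρ := 1 / 2) (by norm_num) hlt) hC.le)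
          have e : ((t : ℂ) + y * Complex.I).re - s₀.re = t + -s₀.re := by simp; ring
          rw [e] at h1
          rw [hre, e, norm_div, norm_norm, Real.norm_of_nonneg (by positivity),
            div_le_iff₀ (by positivity)]
          refine h1.trans (le_of_eq ?_)
          have e2 : (t + -s₀.re) ^ (-(1 / 2) : ℝ) =
              (t + -s₀.re) ^ (-(3 / 2) : ℝ) * (t + -s₀.re) := by
            rw [← Real.rpow_add_one ht0.ne']
            norm_num
          rw [e2]
          field_simp)
  have hcv := continuous_vertical hF.differentiableOn hcb
  have hver := mellin_superposition hX l σ (μ := volume.restrict (Ioc (-R) R))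
      (γ := fun t => c + t * Complex.I)
      (f := fun t => F (c + t * Complex.I) * Complex.I) (by fun_prop)
      (hcv.mul continuous_const).aestronglyMeasurable
      (Eventually.of_forall fun t => by
        rw [hre]
        refine mul_pos hl0 ?_
        simp
        linarith)
      (by
        have : ∀ t : ℝ, (σ - 1 + l * (c + t * Complex.I)).re = l * (c - s₀.re) := fun t => by
          rw [hre]
          simp
        simp only [this]
        exact (((hcv.mul continuous_const).norm.div_const _).continuousOn.integrableOn_Icc).mono_set
          Ioc_subset_Icc_self)
  have hbot := hor (-R) (by simp [abs_of_pos hR])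
  have htop := hor R (le_abs_self R)
  have hloop := hF.loopIntegral_div_sub hcb hσ hR
  have hRR : -R ≤ R := by linarith
  have hexp : ∀ x : ℝ, (x : ℂ) ^ (σ - 2) *
      loopIntegral (fun s => F s * ((x ^ l / X ^ l : ℝ) : ℂ) ^ s) c R =
      -((x : ℂ) ^ (σ - 2) * ∫ t in Ioi c, F (t + (-R : ℝ) * Complex.I) *
          ((x ^ l / X ^ l : ℝ) : ℂ) ^ ((t : ℂ) + (-R : ℝ) * Complex.I)) +
        (x : ℂ) ^ (σ - 2) * (∫ t in Ioc (-R) R, F (c + t * Complex.I) * Complex.I *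
          ((x ^ l / X ^ l : ℝ) : ℂ) ^ ((c : ℂ) + t * Complex.I)) +
        (x : ℂ) ^ (σ - 2) * ∫ t in Ioi c, F (t + R * Complex.I) *
          ((x ^ l / X ^ l : ℝ) : ℂ) ^ ((t : ℂ) + R * Complex.I) := by
    intro x
    rw [loopIntegral, intervalIntegral.integral_of_le hRR]
    simp only [Complex.ofReal_neg, neg_mul, ← sub_eq_add_neg, mul_right_comm _ Complex.I]
    ring
  simp only [hexp]
  refine ⟨(hbot.1.neg.add hver.1).add htop.1, ?_⟩
  have key : ∀ f₁ f₂ f₃ : ℝ → ℂ, IntegrableOn f₁ (Ioo 0 X) → IntegrableOn f₂ (Ioo 0 X) →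
      IntegrableOn f₃ (Ioo 0 X) → ∫ x in Ioo 0 X, (-f₁ x + f₂ x + f₃ x) =
        -(∫ x in Ioo 0 X, f₁ x) + (∫ x in Ioo 0 X, f₂ x) + ∫ x in Ioo 0 X, f₃ x :=
    fun f₁ f₂ f₃ h₁ h₂ h₃ => by
      rw [integral_add (f := fun x => -f₁ x + f₂ x) (h₁.neg.add h₂) h₃,
        integral_add (f := fun x => -f₁ x) h₁.neg h₂, integral_neg]
  rw [key _ _ _ hbot.1 hver.1 htop.1, hbot.2, hver.2, htop.2, ← hloop, loopIntegral,
    intervalIntegral.integral_of_le hRR]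
  simp only [hmul, div_mul_eq_div_div_swap, integral_div, Complex.ofReal_neg, neg_mul,
    ← sub_eq_add_neg, div_mul_eq_mul_div]
  ring

/-! ### The function `ψ` as a Gamma quotient -/

lemma one_lt_natCast_add_div {l m : ℕ} (hl : l ≠ 0) (hm : m ≠ 0) :
    (1 : ℝ) < ((l + m : ℕ) : ℝ) / l := by
  have : (0 : ℝ) < l := by positivity
  have : (0 : ℝ) < m := by positivity
  rw [lt_div_iff₀ (by positivity)]
  push_cast
  linarith

lemma natCast_add_div_sub_one {l m : ℕ} (hl : l ≠ 0) :
    ((l + m : ℕ) : ℝ) / l - 1 = m / l := by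
  have : (l : ℝ) ≠ 0 := Nat.cast_ne_zero.2 hl
  push_cast
  field_simp
  ring

lemma cConst_pos {p : ℝ} (hp : 1 < p) : 0 < cConst p := by
  have : 0 < p - 1 := by linarith
  unfold cConst
  positivity

lemma natCast_mul_log_cConst {l m : ℕ} (hl : l ≠ 0) (hm : m ≠ 0) :
    l * Real.log (cConst (((l + m : ℕ) : ℝ) / l)) =
      ((l + m : ℕ) : ℝ) * Real.log ((l + m : ℕ) : ℝ) - l * Real.log l - m * Real.log m := by
  have hlR : (0 : ℝ) < l := by positivity
  have hmR : (0 : ℝ) < m := by positivity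
  have hkR : (0 : ℝ) < ((l + m : ℕ) : ℝ) := by positivity
  rw [cConst, natCast_add_div_sub_one hl, Real.log_mul (by positivity) (by positivity),
    Real.log_rpow (by positivity), Real.log_rpow (by positivity), Real.log_div hkR.ne' hlR.ne',
    Real.log_div hmR.ne' hlR.ne',
    show 1 - ((l + m : ℕ) : ℝ) / l = -(m / l) by linarith [natCast_add_div_sub_one (m := m) hl]]
  field_simp
  push_cast
  ring

/-- The constant in Stirling's asymptotics of `gammaBinom`. -/
lemma stirling_const_eq {l m : ℕ} (hl : l ≠ 0) (hm : m ≠ 0) (r : ℝ) :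
    (((l + m : ℕ) : ℝ) / m) ^ r * √((l + m : ℕ) / (2 * π * l * m)) =
      (((l + m : ℕ) : ℝ) / l) ^ (r + 1 / 2) /
        ((((l + m : ℕ) : ℝ) / l - 1) ^ (r + 1 / 2) * (√(2 * π) * √l)) := by
  have hlR : (0 : ℝ) < l := by positivity
  have hmR : (0 : ℝ) < m := by positivity
  have hkR : (0 : ℝ) < ((l + m : ℕ) : ℝ) := by positivity
  rw [natCast_add_div_sub_one hl, div_mul_eq_div_div (_ ^ (r + 1 / 2)),
    ← Real.div_rpow (by positivity) (by positivity),
    div_div_div_cancel_right₀ hlR.ne', Real.rpow_add (by positivity), ← Real.sqrt_eq_rpow,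
    ← Real.sqrt_mul (by positivity), mul_div_assoc, ← Real.sqrt_div (by positivity)]
  congr 2
  field_simp

lemma gammaBinom_const_eq {l m : ℕ} (hl : l ≠ 0) (hm : m ≠ 0) (r : ℝ) (w : ℂ) :
    ((l + m : ℕ) : ℂ) ^ (((l + m : ℕ) : ℂ) * w + r) /
        ((l : ℂ) ^ ((l : ℂ) * w) * (m : ℂ) ^ ((m : ℂ) * w + r)) =
      (((((l + m : ℕ) : ℝ) / m) ^ r : ℝ) : ℂ) *
        (cConst (((l + m : ℕ) : ℝ) / l) : ℂ) ^ ((l : ℂ) * w) := by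
  have hlR : (0 : ℝ) < l := by positivity
  have hmR : (0 : ℝ) < m := by positivity
  have hkR : (0 : ℝ) < ((l + m : ℕ) : ℝ) := by positivity
  have hc := cConst_pos (one_lt_natCast_add_div hl hm)
  have hlog := congrArg (fun x : ℝ => (x : ℂ)) (natCast_mul_log_cConst hl hm)
  have hcpow : ∀ n : ℕ, n ≠ 0 → ∀ s : ℂ, (n : ℂ) ^ s = Complex.exp ((Real.log n : ℝ) * s) :=
    fun n hn s => by
      rw [Complex.cpow_def_of_ne_zero (Nat.cast_ne_zero.2 hn), Complex.ofReal_log n.cast_nonneg,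
        Complex.ofReal_natCast]
  rw [hcpow _ (by lia), hcpow l hl, hcpow m hm,
    Complex.cpow_def_of_ne_zero (Complex.ofReal_ne_zero.2 hc.ne'), ← Complex.ofReal_log hc.le,
    Real.rpow_def_of_pos (by positivity), Real.log_div hkR.ne' hmR.ne', Complex.ofReal_exp,
    ← Complex.exp_add, ← Complex.exp_add, ← Complex.exp_sub]
  congr 1
  simp only [Complex.ofReal_mul, Complex.ofReal_sub, Complex.ofReal_natCast] at hlog ⊢
  linear_combination (-w) * hlog

lemma gammaQuotient_eq_gammaBinom {l m : ℕ} (hl : l ≠ 0) (r : ℝ) (σ : ℂ) :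
    gammaQuotient (((l + m : ℕ) : ℝ) / l) r σ = gammaBinom l m r ((σ - 1) / l) := by
  have hlC : (l : ℂ) ≠ 0 := Nat.cast_ne_zero.2 hl
  have e := congrArg (fun x : ℝ => (x : ℂ)) (natCast_add_div_sub_one (m := m) hl)
  simp only [Complex.ofReal_sub, Complex.ofReal_one] at e
  rw [gammaQuotient, gammaBinom, e]
  push_cast
  congr 3
  · field_simp
  · field_simp
    ring
  · field_simp

lemma psi_eq_gammaQuotient {p r : ℝ} {σ : ℂ} (hp : 1 < p) (hσ : 1 - (1 + r) / p < σ.re) :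
    psi p r σ = gammaQuotient p r σ := by
  have hpos : 0 < ((σ - 1) * p + r + 1).re := by
    have hp0 : 0 < p := by linarith
    have h : 1 - σ.re < (1 + r) / p := by linarith
    rw [lt_div_iff₀ hp0] at h
    simp
    linarith
  have hdiff : DifferentiableAt ℂ (gammaQuotient p r) σ := by
    have e : gammaQuotient p r = fun σ : ℂ => Complex.Gamma ((σ - 1) * p + r + 1) *
        ((Complex.Gamma σ)⁻¹ * (Complex.Gamma ((σ - 1) * (p - 1) + r + 1))⁻¹) := by
      funext σ
      rw [gammaQuotient, div_eq_mul_inv, mul_inv]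
    rw [e]
    refine DifferentiableAt.mul ?_ (DifferentiableAt.mul ?_ ?_)
    · refine DifferentiableAt.comp σ (Complex.differentiableAt_Gamma _ fun n hn => ?_)
        (by fun_prop)
      rw [hn] at hpos
      have : (0 : ℝ) ≤ n := n.cast_nonneg
      simp at hpos
      linarith
    · exact Complex.differentiable_one_div_Gamma σ
    · exact (Complex.differentiable_one_div_Gamma _).comp σ (by fun_prop)
  exact (hdiff.continuousAt.tendsto.mono_left nhdsWithin_le_nhds).limUnder_eq

/-- `ψ_{p,r}` in terms of the quotient of Gamma products in the Meijer kernel. -/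
theorem psi_eq_mul_gammaRatio {l m : ℕ} (hl : l ≠ 0) (hm : m ≠ 0) {r : ℝ} {σ : ℂ}
    (hσ : 1 - (1 + r) / (((l + m : ℕ) : ℝ) / l) < σ.re) :
    psi (((l + m : ℕ) : ℝ) / l) r σ =
      (((((l + m : ℕ) : ℝ) / m) ^ r * √((l + m : ℕ) / (2 * π * l * m)) : ℝ) : ℂ) *
        (cConst (((l + m : ℕ) : ℝ) / l) : ℂ) ^ (σ - 1) *
          gammaRatio (alphaParam (l + m) l r) (betaParam (l + m) r) ((1 - σ) / l) := by
  have hlC : (l : ℂ) ≠ 0 := Nat.cast_ne_zero.2 hl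
  have hlR : (0 : ℝ) < l := by positivity
  have hkR : (0 : ℝ) < ((l + m : ℕ) : ℝ) := by positivity
  rw [psi_eq_gammaQuotient (one_lt_natCast_add_div hl hm) hσ, gammaQuotient_eq_gammaBinom hl,
    gammaBinom_eq_mul_gammaRatio hl hm, gammaBinom_const_eq hl hm, mul_div_cancel₀ _ hlC, ← neg_div,
    neg_sub]
  · push_cast
    ring
  · intro i
    have h1 : ((σ - 1) / l).re = (σ.re - 1) / l := by
      rw [← Complex.ofReal_natCast, Complex.div_ofReal_re]
      simp
    have h2 : 1 - σ.re < (1 + r) / (((l + m : ℕ) : ℝ) / l) := by linarith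
    have h3 : (1 - σ.re) / l < (1 + r) / ((l + m : ℕ) : ℝ) := by
      rw [div_lt_iff₀ hlR]
      refine h2.trans_le (le_of_eq ?_)
      field_simp
    have h4 : (1 + r) / ((l + m : ℕ) : ℝ) ≤ betaParam (l + m) r i := by
      have : (0 : ℝ) ≤ ((i : ℕ) : ℝ) := Nat.cast_nonneg _
      exact div_le_div_of_nonneg_right (by linarith) hkR.le
    rw [h1, show (σ.re - 1) / (l : ℝ) = -((1 - σ.re) / l) by ring]
    linarith

/-! ### Inverse Mellin transforms and Meijer functions -/

lemma div_pow_mem_Ioo {X x : ℝ} (hx : x ∈ Ioo 0 X) {l : ℕ} (hl : l ≠ 0) :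
    x ^ l / X ^ l ∈ Ioo (0 : ℝ) 1 := by
  have hX : 0 < X := hx.1.trans hx.2
  have := hx.1
  refine ⟨by positivity, ?_⟩
  rw [div_lt_one (by positivity)]
  exact pow_lt_pow_left₀ hx.2 hx.1.le hl

/-- Improper integrals along `Re σ = d` become Meijer integrals along `Re s = (1 - d) / l` under
`σ = 1 - l s`. The substitution reverses the direction of the line, so the two ends are swapped. -/
theorem IsSlitDecaying.hasInverseMellin {F : ℂ → ℂ} {b d x X A : ℝ} (hF : IsSlitDecaying F b)
    {l : ℕ} (hl : l ≠ 0) (hd : (1 - d) / l < b) (hx : x ∈ Ioo 0 X) {f : ℂ → ℂ}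
    (hf : ∀ σ : ℂ, σ.re = d → f σ = A * (X : ℂ) ^ (σ - 1) * F ((1 - σ) / l)) :
    HasInverseMellin f d x (((A * l / x : ℝ) : ℂ) * (1 / (2 * (π : ℂ) * Complex.I) *
      loopIntegral (fun s => F s * ((x ^ l / X ^ l : ℝ) : ℂ) ^ s) ((1 - d) / l) 1)) := by
  set c := (1 - d) / l with hc
  set z : ℝ := x ^ l / X ^ l with hz
  obtain ⟨hz0, hz1⟩ := div_pow_mem_Ioo hx hl
  rw [← hz] at hz0 hz1
  have hx0 : 0 < x := hx.1
  have hX0 : 0 < X := hx.1.trans hx.2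
  have hxC : (x : ℂ) ≠ 0 := Complex.ofReal_ne_zero.2 hx0.ne'
  have hXC : (X : ℂ) ≠ 0 := Complex.ofReal_ne_zero.2 hX0.ne'
  have hlR : (0 : ℝ) < l := by positivity
  have hlC : (l : ℂ) ≠ 0 := Nat.cast_ne_zero.2 hl
  let K : ℝ → ℂ := fun y => F (c + y * Complex.I) * (z : ℂ) ^ ((c : ℂ) + y * Complex.I)
  have hKc : Continuous K := continuous_vertical
    (hF.differentiableOn.mul (differentiable_const_ofReal_cpow hz0).differentiableOn) hd
  have hfK : ∀ t : ℝ, (x : ℂ) ^ (-((d : ℂ) + t * Complex.I)) * f ((d : ℂ) + t * Complex.I) =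
      ((A / x : ℝ) : ℂ) * K (-t / l) := by
    intro t
    have e1 : (1 - ((d : ℂ) + t * Complex.I)) / l = c + ((-t / l : ℝ) : ℂ) * Complex.I := by
      rw [hc]
      push_cast
      field_simp
      ring
    have e2 : (l : ℂ) * (c + ((-t / l : ℝ) : ℂ) * Complex.I) = 1 - ((d : ℂ) + t * Complex.I) := by
      rw [← e1]
      field_simp
    have e3 := cpow_mul_div_pow_cpow hX0 hx0 l (-1) (c + ((-t / l : ℝ) : ℂ) * Complex.I)
    rw [e2, Complex.cpow_neg_one, ← hz] at e3
    rw [hf _ (by simp), e1]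
    simp only [K]
    rw [show -((d : ℂ) + t * Complex.I) = -1 + (1 - ((d : ℂ) + t * Complex.I)) by ring,
      show (d : ℂ) + t * Complex.I - 1 = -(1 - ((d : ℂ) + t * Complex.I)) by ring]
    rw [Complex.ofReal_div A x]
    linear_combination -(A : ℂ) * F (c + ((-t / l : ℝ) : ℂ) * Complex.I) * e3
  refine ⟨fun S T => ?_, ?_⟩
  · simp only [hfK]
    exact (continuous_const.mul (hKc.comp (by fun_prop))).intervalIntegrable _ _
  · have h := hF.tendsto_integral_vertical_mul_cpow hd one_pos hz0 hz1
    have hsw : Tendsto (fun w : ℝ × ℝ => (w.2 / l, w.1 / l)) (atTop ×ˢ atTop) (atTop ×ˢ atTop) :=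
      (tendsto_snd.atTop_div_const hlR).prodMk (tendsto_fst.atTop_div_const hlR)
    have h1 := ((h.comp hsw).const_mul (1 / (2 * (π : ℂ) * Complex.I))).const_mul
      (((A * l / x : ℝ) : ℂ))
    refine h1.congr fun w => ?_
    have e4 := intervalIntegral.integral_comp_div (a := -w.1) (b := w.2) K (neg_ne_zero.2 hlR.ne')
    have e5 : ∀ t : ℝ, t / -(l : ℝ) = -t / l := fun t => by rw [div_neg, neg_div]
    simp only [e5, neg_neg, Complex.real_smul] at e4
    rw [neg_div, intervalIntegral.integral_symm (-(w.2 / l)) (w.1 / l)] at e4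
    simp only [Function.comp_apply, hfK]
    rw [intervalIntegral.integral_mul_const, intervalIntegral.integral_mul_const,
      intervalIntegral.integral_const_mul, e4]
    simp only [K]
    push_cast
    ring

theorem IsSlitDecaying.hasMeijerG {n : ℕ} {a b : Fin n → ℝ} {β z : ℝ}
    (hF : IsSlitDecaying (gammaRatio a b) β) (hβ : ∃ j, b j = β) (hz : 0 < z) (hz1 : z < 1)
    {c₀ : ℝ} (hc₀ : c₀ < β) :
    HasMeijerG (fun j => (a j : ℂ)) (fun j => (b j : ℂ)) (z : ℂ)
      (1 / (2 * (π : ℂ) * Complex.I) *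
        loopIntegral (fun s => gammaRatio a b s * (z : ℂ) ^ s) c₀ 1) := by
  intro c R hR hc _
  obtain ⟨j, rfl⟩ := hβ
  have hcb : c < b j := by simpa using hc j
  have hz0 : (z : ℂ) ≠ 0 := Complex.ofReal_ne_zero.2 hz.ne'
  refine ⟨?_, ?_, hF.integrableOn_mul_cpow hR hz hz1 (le_abs_self R), ?_⟩
  · have := hF.integrableOn_mul_cpow (c := c) (y := -R) hR hz hz1 (by simp [abs_of_pos hR])
    simp only [Complex.ofReal_neg, neg_mul, ← sub_eq_add_neg] at this
    exact this
  · exact (continuous_vertical (hF.differentiableOn.mul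
      (differentiable_const_ofReal_cpow hz).differentiableOn) hcb).intervalIntegrable _ _
  · rw [← hF.loopIntegral_mul_cpow_eq hcb hc₀ hR one_pos hz hz1]
    rfl

theorem theorem4p2 (k l : ℕ) (hl : 1 ≤ l) (hlk : l < k) (p : ℝ) (hp : p = (k : ℝ) / (l : ℝ))
    (r : ℝ) :
    ∃ V : ℝ → ℂ,
      (∀ d : ℝ, 1 - (1 + r) / p < d → ∀ x ∈ Ioo (0 : ℝ) (cConst p),
        HasInverseMellin (psi p r) d x (V x)) ∧
      (∀ x ∈ Ioo (0 : ℝ) (cConst p), ∃ g : ℂ,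
        HasMeijerG (fun j => (alphaParam k l r j : ℂ)) (fun j => (betaParam k r j : ℂ))
          ((x ^ l / cConst p ^ l : ℝ) : ℂ) g ∧
        V x = ((p ^ (r + 1 / 2) * √(l : ℝ) /
          (x * (p - 1) ^ (r + 1 / 2) * √(2 * π)) : ℝ) : ℂ) * g) ∧
      (∀ σ : ℂ, 1 - (1 + r) / p < σ.re →
        IntegrableOn (fun x : ℝ => (x : ℂ) ^ (σ - 1) * V x) (Ioo 0 (cConst p)) ∧
        psi p r σ = ∫ x in Ioo (0 : ℝ) (cConst p), (x : ℂ) ^ (σ - 1) * V x) := by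
  obtain ⟨m, rfl⟩ := Nat.exists_eq_add_of_le hlk.le
  have hl0 : l ≠ 0 := by lia
  have hm0 : m ≠ 0 := by lia
  have hlR : (0 : ℝ) < l := by positivity
  have hmR : (0 : ℝ) < m := by positivity
  have hkR : (0 : ℝ) < ((l + m : ℕ) : ℝ) := by positivity
  have hlC : (l : ℂ) ≠ 0 := Nat.cast_ne_zero.2 hl0
  subst hp
  set X := cConst (((l + m : ℕ) : ℝ) / l) with hX
  have hX0 : 0 < X := cConst_pos (one_lt_natCast_add_div hl0 hm0)
  set F := gammaRatio (alphaParam (l + m) l r) (betaParam (l + m) r) with hFdef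
  set A : ℝ := (((l + m : ℕ) : ℝ) / m) ^ r * √((l + m : ℕ) / (2 * π * l * m)) with hA
  set b : ℝ := (r + 1) / ((l + m : ℕ) : ℝ) with hb
  have hbeta : ∀ j, b ≤ betaParam (l + m) r j := fun j => by
    have : (0 : ℝ) ≤ ((j : ℕ) : ℝ) := Nat.cast_nonneg _
    exact div_le_div_of_nonneg_right (by linarith) hkR.le
  have hbex : ∃ j, betaParam (l + m) r j = b := ⟨⟨0, by lia⟩, by simp [betaParam, hb]⟩
  have hF : IsSlitDecaying F b :=
    isSlitDecaying_gammaRatio _ _ hbeta (sum_alphaParam_sub_sum_betaParam hl0 hm0 r)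
  have hline : ∀ d : ℝ, 1 - (1 + r) / (((l + m : ℕ) : ℝ) / l) < d → (1 - d) / l < b := by
    intro d hd
    rw [div_lt_iff₀ hlR]
    have : b * l = (1 + r) / (((l + m : ℕ) : ℝ) / l) := by
      rw [hb]
      field_simp
      ring
    linarith
  have hbound : b - 1 < b := by linarith
  -- `V` is defined by the loop with `c = b - 1` and `R = 1`; every other loop gives the same value
  refine ⟨fun x => ((A * l / x : ℝ) : ℂ) * (1 / (2 * (π : ℂ) * Complex.I) *
      loopIntegral (fun s => F s * ((x ^ l / X ^ l : ℝ) : ℂ) ^ s) (b - 1) 1), ?_, ?_, ?_⟩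
  · intro d hd x hx
    obtain ⟨hz0, hz1⟩ := div_pow_mem_Ioo hx hl0
    beta_reduce
    rw [hF.loopIntegral_mul_cpow_eq hbound (hline d hd) one_pos one_pos hz0 hz1]
    exact hF.hasInverseMellin hl0 (hline d hd) hx fun σ hσ =>
      psi_eq_mul_gammaRatio hl0 hm0 (by rwa [hσ])
  · intro x hx
    obtain ⟨hz0, hz1⟩ := div_pow_mem_Ioo hx hl0
    refine ⟨_, hF.hasMeijerG hbex hz0 hz1 hbound, ?_⟩
    rw [hA, stirling_const_eq hl0 hm0]
    have h1 : (0 : ℝ) < ((l + m : ℕ) : ℝ) / l - 1 := by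
      rw [natCast_add_div_sub_one hl0]
      positivity
    have h2 : 0 < (((l + m : ℕ) : ℝ) / l - 1) ^ (r + 1 / 2) := Real.rpow_pos_of_pos h1 _
    have h3 : 0 < √(l : ℝ) := Real.sqrt_pos.2 hlR
    have h4 : 0 < √(2 * π) := Real.sqrt_pos.2 (by positivity)
    have h5 : (l : ℝ) = √(l : ℝ) * √(l : ℝ) := (Real.mul_self_sqrt hlR.le).symm
    have hx0 := hx.1
    generalize (((l + m : ℕ) : ℝ) / l - 1) ^ (r + 1 / 2) = u at *
    generalize (((l + m : ℕ) : ℝ) / l) ^ (r + 1 / 2) = v at *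
    generalize √(l : ℝ) = w at *
    rw [h5]
    field_simp
    rfl
  · intro σ hσ
    have hs := hline σ.re hσ
    -- the loop has to pass between the pole `(1 - σ) / l` and the ray `[b, ∞)`
    obtain ⟨c, hc1, hc2⟩ := exists_between hs
    have hσc : ((1 - σ) / l).re < c := by
      rw [← Complex.ofReal_natCast, Complex.div_ofReal_re]
      simpa using hc1
    have hM := hF.mellin_loopIntegral hc2 one_pos hX0 hl0 hσc
    have hV : ∀ x ∈ Ioo 0 X, ((A * l / (2 * π * Complex.I) : ℂ)) * ((x : ℂ) ^ (σ - 2) *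
        loopIntegral (fun s => F s * ((x ^ l / X ^ l : ℝ) : ℂ) ^ s) c 1) =
        (x : ℂ) ^ (σ - 1) * (((A * l / x : ℝ) : ℂ) * (1 / (2 * (π : ℂ) * Complex.I) *
      loopIntegral (fun s => F s * ((x ^ l / X ^ l : ℝ) : ℂ) ^ s) (b - 1) 1)) := by
      intro x hx
      obtain ⟨hz0, hz1⟩ := div_pow_mem_Ioo hx hl0
      have hx0 : (x : ℂ) ≠ 0 := Complex.ofReal_ne_zero.2 hx.1.ne'
      have e : (x : ℂ) ^ (σ - 1) = (x : ℂ) ^ (σ - 2) * x := by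
        rw [show σ - 1 = σ - 2 + 1 by ring, Complex.cpow_add _ _ hx0, Complex.cpow_one]
      rw [hF.loopIntegral_mul_cpow_eq hbound hc2 one_pos one_pos hz0 hz1, e]
      push_cast
      field_simp
    refine ⟨IntegrableOn.congr_fun (hM.1.const_mul _) hV measurableSet_Ioo, ?_⟩
    have hψ : psi (((l + m : ℕ) : ℝ) / l) r σ = A * (X : ℂ) ^ (σ - 1) * F ((1 - σ) / l) :=
      psi_eq_mul_gammaRatio hl0 hm0 hσ
    rw [← setIntegral_congr_fun measurableSet_Ioo hV, integral_const_mul, hM.2, hψ]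
    have := Complex.I_ne_zero
    have hpi : (π : ℂ) ≠ 0 := Complex.ofReal_ne_zero.2 Real.pi_pos.ne'
    field_simp
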